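/- Theorem. Let $G$ be a finite connected graph (loops and multiple edges allowed) that is outerplanar, i.e. it can be drawn in the plane without crossings so that all its vertices lie on the boundary of the unbounded face. Let $q$ be a vertex of $G$ and $\mathbf{k}$ a field. (A crossing-free drawing of a connected graph is recorded by its combinatorial data: the counterclockwise cyclic order of the edge ends at each vertex, subject to Euler's formula, and the choice of the unbounded face.) A $q$-rooted boundary tree $T$ is obtained from such a drawing by walking once counterclockwise along the boundary of the unbounded face, starting at $q$, and adding the oriented edge $(u,v)$ to $T$ whenever it is walked along and $v$ is visited for the first time; the edges of $T$ are ordered in the order in which they were walked along. Then a $q$-rooted boundary tree exists, and every $q$-rooted boundary tree $T$ is an ordered $q$-rooted spanning tree (a spanning tree with edges oriented away from $q$ and totally ordered so that edges nearer to $q$ on a path precede those further away). Let $T$ be any $q$-rooted boundary tree. Compatible pairs of a reference orientation of $G$ and a total order $<$ on $E(G)$, that is, pairs that extend the orientation and the order of the edges of $T$ and in which every edge outside $T$ is greater than all edges of $T$, exist. For every compatible pair the following two statements hold. (a) For nonempty $U\subseteq V(G)\setminus\{q\}$ and $u\in U$ let $d_{U,T}(u)$ be the number of edges $\{u,v\}$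 with $v\notin U$ that are not the $<$-minimum edge of the cut $E(U,U^c)$. Let $R=\mathbf{k}[x_v : v\neq q]$ and let $I^{-1}_{(G,q,T)}\subseteq R$ be the ideal generated by the monomials $\prod_{u\in U}x_u^{d_{U,T}(u)}$ over all nonempty $U\subseteq V(G)\setminus\{q\}$. Then $$\mathrm{Hilb}(R/I^{-1}_{(G,q,T)};y)=y^{g}\,T_G(0,1/y),$$ where $g=|E(G)|-|V(G)|+1$ and $T_G(x,y)$ is the Tutte polynomial of $G$. (b) Call $c=(c_v)_{v\ne q}\in\mathbb{Z}^{V(G)\setminus\{q\}}$ a subparking function if every nonempty $U\subseteq V(G)\setminus\{q\}$ contains some $u$ with $0\le c_u<d_{U,T}(u)$. A partial orientation orients some of the edges of $G$ and leaves the others neutral. It is acyclic–cut internal if it has no directed cycle (in particular, loops are neutral) and, for every $U$ with $U,U^c\neq\emptyset$ such that no edge of the cut is oriented from $U^c$ to $U$, the $<$-minimum edge of the cut $E(U,U^c)$ is neutral and the cut contains an oriented edge crossing it in the same direction as the reference orientation of that minimum edge. Then the set of subparking functions is exactly the set of the restricted divisors $(\mathrm{indeg}_{\mathcal{O}}(v)-1)_{v\ne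 q}$ of the acyclic–cut internal partial orientations $\mathcal{O}$. -/

import Mathlib

open scoped Classical

noncomputable section

/-- A graph with vertex set `V` and edge set `E`; loops and multiple edges are allowed.
The edge `e` joins `(ends e).1` and `(ends e).2`. The order of this pair has no meaning for the
graph: it only gives names to the two orientations of each edge (also of a loop). -/
structure Multigraph (V E : Type*) where
  ends : E → V × V

namespace Multigraph

variable {V E : Type*}

/-- The oriented edges: `(e, true)` and `(e, false)` are the two orientations of the edge `e`. -/
abbrev Dart (E : Type*) := E × Bool

/-- The other orientation of the same edge. -/
def Dart.rev : Equiv.Perm (Dart E) := (Equiv.refl E).prodCongr Equiv.boolNot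

/-- The tail of an oriented edge. -/
def src (G : Multigraph V E) (d : Dart E) : V := if d.2 then (G.ends d.1).1 else (G.ends d.1).2

/-- The head of an oriented edge. -/
def tgt (G : Multigraph V E) (d : Dart E) : V := if d.2 then (G.ends d.1).2 else (G.ends d.1).1

/-- `e = {u, v}`. -/
def Joins (G : Multigraph V E) (e : E) (u v : V) : Prop := s((G.ends e).1, (G.ends e).2) = s(u, v)

/-- Any two vertices are joined by a path (used together with the presence of a vertex). -/
def Connected (G : Multigraph V E) : Prop :=
  ∀ u v : V, Relation.ReflTransGen (fun a b => ∃ e, G.Joins e a b) u v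

/-! ### The Tutte polynomial -/

/-- The number of connected components of the spanning subgraph with edge set `A`. -/
def numComponents (G : Multigraph V E) (A : Set E) : ℕ :=
  Nat.card (Quot (fun u v : V => ∃ e ∈ A, G.Joins e u v))

/-- The Tutte polynomial `∑_{A ⊆ E} (x - 1)^(κ(A) - κ(E)) (y - 1)^(κ(A) + |A| - |V|)`, where `x` is
the variable `X 0` and `y` is the variable `X 1`. No natural number subtraction truncates here. -/
def tutte (G : Multigraph V E) [Fintype E] : MvPolynomial (Fin 2) ℤ :=
  ∑ A : Finset E,
    (MvPolynomial.X 0 - 1) ^ (G.numComponents (A : Set E) - G.numComponents Set.univ) *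
      (MvPolynomial.X 1 - 1) ^ (G.numComponents (A : Set E) + A.card - Nat.card V)

/-- The cyclomatic number `g = |E| - |V| + 1` of a connected graph. -/
def genus (_G : Multigraph V E) : ℤ := (Nat.card E : ℤ) - Nat.card V + 1

/-! ### Cuts, ordered rooted spanning trees, compatible edge orders and reference orientations -/

/-- `E(U, Uᶜ)`, the set of edges with one end in `U` and the other end outside `U`. -/
def cutEdges (G : Multigraph V E) (U : Set V) : Set E :=
  {e | ∃ u ∈ U, ∃ v ∉ U, G.Joins e u v}

/-- `e` is the minimum of the edge set `C` with respect to the strict total order `lt`. -/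
def IsMinEdge (lt : E → E → Prop) (C : Set E) (e : E) : Prop :=
  e ∈ C ∧ ∀ f ∈ C, f ≠ e → lt e f

/-- `T` lists, in increasing order, the edges of an ordered `q`-rooted spanning tree, each of them
oriented away from `q`: every vertex other than `q` is the head of exactly one edge of `T`, no edge
of `T` has head `q`, and the tail of each edge is `q` or the head of an earlier edge, so that the
order of the edges is consistent with ancestry. -/
structure IsOrderedRootedTree (G : Multigraph V E) (q : V) (T : List (Dart E)) : Prop where
  nodup : (T.map G.tgt).Nodup
  mem_iff : ∀ v, v ∈ T.map G.tgt ↔ v ≠ q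
  tail : ∀ (L : List (Dart E)) (d : Dart E) (L' : List (Dart E)),
    T = L ++ d :: L' → G.src d = q ∨ G.src d ∈ L.map G.tgt

/-- The reference orientation `ref` (choosing the orientation `e⁺ = (e, ref e)` of every edge `e`)
and the strict total order `lt` on the edges are compatible with the ordered rooted tree `T`: they
extend the orientation and the order of the edges of `T`, and every edge outside `T` is greater
than all edges of `T`. -/
structure Compatible (T : List (Dart E)) (ref : E → Bool) (lt : E → E → Prop) : Prop where
  total : IsStrictTotalOrder E lt
  ref_eq : ∀ d ∈ T, ref d.1 = d.2
  extends_order : (T.map Prod.fst).Pairwise lt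
  tree_lt : ∀ d ∈ T, ∀ f, f ∉ T.map Prod.fst → lt d.1 f

/-! ### Subparking functions and the monomial ideal -/

/-- For `u ∈ U`, the number of edges in `E(U, Uᶜ)` that contain `u` and are not the minimum edge of
`E(U, Uᶜ)`. -/
def cutDeg (G : Multigraph V E) (lt : E → E → Prop) (U : Set V) (u : V) : ℕ :=
  Set.ncard {e | (∃ v ∉ U, G.Joins e u v) ∧ ¬ IsMinEdge lt (G.cutEdges U) e}

/-- The set of subparking functions. -/
def subparking (G : Multigraph V E) (q : V) (lt : E → E → Prop) : Set ({v : V // v ≠ q} → ℤ) :=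
  {c | ∀ U : Set V, U.Nonempty → q ∉ U →
    ∃ u : {v : V // v ≠ q}, u.1 ∈ U ∧ 0 ≤ c u ∧ c u < G.cutDeg lt U u.1}

/-- The monomial ideal generated by the monomials `∏_{u ∈ U} x_u ^ cutDeg U u`, where `U` runs over
the nonempty sets of vertices that do not contain `q`. -/
def subparkingIdeal (k : Type*) [Field k] (G : Multigraph V E) (q : V) (lt : E → E → Prop) :
    Ideal (MvPolynomial {v : V // v ≠ q} k) :=
  Ideal.span {f | ∃ U : Finset {v : V // v ≠ q}, U.Nonempty ∧
    f = ∏ u ∈ U, MvPolynomial.X u ^ G.cutDeg lt (Subtype.val '' (U : Set {v : V // v ≠ q})) u.1}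

/-! ### Partial orientations -/

/-- A partial orientation: a set of oriented edges with at most one orientation of each edge. -/
def IsPartialOrientation (O : Set (Dart E)) : Prop := ∀ e : E, ¬ ((e, true) ∈ O ∧ (e, false) ∈ O)

/-- The edge `e` is neutral. -/
def IsNeutral (O : Set (Dart E)) (e : E) : Prop := ∀ b, (e, b) ∉ O

/-- There is no directed cycle `d 0, …, d n`; here `i + 1` is taken modulo `n + 1`, and a cycle
consists of distinct edges. -/
def IsAcyclic (G : Multigraph V E) (O : Set (Dart E)) : Prop :=
  ¬ ∃ (n : ℕ) (d : Fin (n + 1) → Dart E), (Function.Injective fun i => (d i).1) ∧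
    (∀ i, G.tgt (d i) = G.src (d (i + 1))) ∧ ∀ i, d i ∈ O

/-- `(U, Uᶜ)` is a potential cut: every edge of the cut is neutral or oriented from `U` to `Uᶜ`. -/
def IsPotentialCut (G : Multigraph V E) (O : Set (Dart E)) (U : Set V) : Prop :=
  U.Nonempty ∧ Uᶜ.Nonempty ∧ ∀ d : Dart E, G.src d ∈ U → G.tgt d ∉ U → Dart.rev d ∉ O

/-- The minimum edge of each potential cut is neutral, and the cut contains an oriented edge which
crosses the cut in the same direction as the reference orientation of the minimum edge. -/
def IsCutInternal (G : Multigraph V E) (ref : E → Bool) (lt : E → E → Prop)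
    (O : Set (Dart E)) : Prop :=
  ∀ U, G.IsPotentialCut O U → ∀ e, IsMinEdge lt (G.cutEdges U) e →
    IsNeutral O e ∧
      ∃ d ∈ O, d.1 ∈ G.cutEdges U ∧ (G.src d ∈ U ↔ G.src (e, ref e) ∈ U)

/-- The acyclic-cut internal partial orientations. -/
def acyclicCutInternal (G : Multigraph V E) (ref : E → Bool) (lt : E → E → Prop) :
    Set (Set (Dart E)) :=
  {O | IsPartialOrientation O ∧ G.IsAcyclic O ∧ G.IsCutInternal ref lt O}

/-- The divisor `∑_v (indeg v - 1) (v)` of a partial orientation, restricted to `v ≠ q`. -/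
def divisor (G : Multigraph V E) (q : V) (O : Set (Dart E)) : {v : V // v ≠ q} → ℤ :=
  fun v => (Set.ncard {d ∈ O | G.tgt d = v.1} : ℤ) - 1

/-! ### Outerplanar drawings and boundary trees -/

/-- A drawing of a connected graph in the oriented plane without crossings such that all vertices
lie on the boundary of the unbounded face, recorded as a planar rotation system.

`rot` sends an oriented edge to the next one counterclockwise around its tail. A tour of the
boundary of a face, with the face on the right-hand side, goes from `d` on to `rot (rev d)`; so the
faces correspond to the cycles of this permutation, except that a drawing without edges has one
face. The drawing is planar (of genus zero) if and only if Euler's formula holds. The set `outer`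
consists of the oriented edges which have the unbounded face on their right-hand side. -/
structure OuterplanarDrawing (G : Multigraph V E) where
  rot : Equiv.Perm (Dart E)
  rot_sameCycle : ∀ d d', rot.SameCycle d d' ↔ G.src d = G.src d'
  euler : Nat.card V +
    max 1 (Nat.card (Quotient (Equiv.Perm.SameCycle.setoid (rot * Dart.rev)))) = Nat.card E + 2
  outer : Set (Dart E)
  outer_nonempty : Nonempty E → outer.Nonempty
  outer_face : ∀ d ∈ outer, ∀ d', d' ∈ outer ↔ (rot * Dart.rev).SameCycle d d'
  vertex_outer : Nonempty E → ∀ v, ∃ d ∈ outer, G.src d = v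

/-- The next oriented edge on the tour of the boundary of the face on the right-hand side. -/
def OuterplanarDrawing.faceNext {G : Multigraph V E} (P : G.OuterplanarDrawing) :
    Equiv.Perm (Dart E) := P.rot * Dart.rev

/-- The graph can be drawn in the plane without crossings and with all its vertices on the boundary
of the unbounded face. -/
def IsOuterplanar (G : Multigraph V E) : Prop := Nonempty G.OuterplanarDrawing

/-- `w` is the list of the oriented edges along which one walks when one walks once around the
boundary of the unbounded face, counterclockwise and starting at `q`. -/
def OuterplanarDrawing.IsBoundaryWalk {G : Multigraph V E} (P : G.OuterplanarDrawing) (q : V)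
    (w : List (Dart E)) : Prop :=
  (IsEmpty E ∧ w = []) ∨
    ∃ d ∈ P.outer, G.src d = q ∧
      w = (List.range (Function.minimalPeriod P.faceNext d)).map
        fun i => (P.faceNext^[i]) d

/-- The oriented edges of the walk `w` whose head is visited for the first time, in the order of
the walk; the vertices in `seen` have been visited before. -/
def firstVisits (G : Multigraph V E) : List V → List (Dart E) → List (Dart E)
  | _, [] => []
  | seen, d :: w =>
    if G.tgt d ∈ seen then firstVisits G seen w else d :: firstVisits G (G.tgt d :: seen) w

/-- `T` is a `q`-rooted boundary tree. -/
def IsBoundaryTree (G : Multigraph V E) (q : V) (T : List (Dart E)) : Prop :=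
  ∃ (P : G.OuterplanarDrawing) (w : List (Dart E)),
    P.IsBoundaryWalk q w ∧ T = G.firstVisits [q] w

end Multigraph

/-- The Hilbert series `∑ᵢ dim (R/I)ᵢ yⁱ` of the quotient of the polynomial ring `R = k[σ]` by a
homogeneous ideal `I`, where `(R/I)ᵢ` is the image of the homogeneous polynomials of degree `i`. -/
def hilbertSeries {σ k : Type*} [Field k] (I : Ideal (MvPolynomial σ k)) : PowerSeries ℤ :=
  PowerSeries.mk fun i => (Module.finrank k
    ((MvPolynomial.homogeneousSubmodule σ k i).map (Ideal.Quotient.mkₐ k I).toLinearMap) : ℤ)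

end

/-! ### Outer orders, and deletion and contraction of root edges for subparking functions -/

namespace Multigraph

variable {V E : Type*}

/-! Number the vertices by the time of their first visit on the boundary walk. Two facts about this
order carry the theorem: no two edges cross when the vertices are put on a line in this order, and
every tree edge joins its head to the latest of the head's earlier neighbours
(`IsBoundaryTree.exists_isBoundaryOrder`). Both come from a discrete Jordan curve argument
(`OuterplanarDrawing.separation`): by Euler's formula every cycle modulo two bounds a set of faces,
so an edge between two vertices of the outer tour separates the two arcs of the tour.

For every compatible edge order the minimum edge of a cut is the tree edge that enters the first
vertex of the side without `q` (`IsBoundaryOrder.isMinEdge_iff`). Hence the bound in the definition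
of subparking functions is the number of edges leaving `U` at `u`, lowered by one exactly when `u`
is the first vertex of `U`. From here on only the vertex order matters.

Part (a) is a deletion-contraction argument. Let `e` be an edge outside the tree joining the root to
`w`. Subparking functions positive at `w` correspond to those of the graph without `e`, after
subtracting one at `w`; those vanishing at `w` are the ones of the graph with `e` contracted
(`IsRootEdge.subpark_eq`). Both properties of the order survive either operation. If no such `e`
exists, then either only loops at the root are left, or there is a bridge
(`IsOuterOrder.exists_bridge`), and then there are no subparking functions and the Tutte polynomial
vanishes at `x = 0`. The Tutte polynomial obeys the same recursion, and the subparking functions are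
the exponents of the monomials that survive in the quotient ring.

For (b), running the same recursion backwards and orienting each removed edge away from the root
realizes every subparking function by a suitable orientation (`IsOuterOrder.exists_isInternal`).
Conversely, in a set `U` without `q` an acyclic orientation has a source `u`, whose incoming edges
all come from outside `U`. If `u` is the first vertex of `U`, its tree edge is an edge leaving `U`
that does not contribute to the indegree, since an acyclic-cut internal orientation never directs a
tree edge away from the root (`IsBoundaryOrder.notMem_of_mem_tree`). -/

theorem Joins.symm {G : Multigraph V E} {e : E} {u v : V} (h : G.Joins e u v) : G.Joins e v u :=
  h.trans Sym2.eq_swap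

theorem Joins.ends_eq {G : Multigraph V E} {e : E} {a b c d : V} (h : G.Joins e a b)
    (h' : G.Joins e c d) : (a = c ∧ b = d) ∨ (a = d ∧ b = c) :=
  Sym2.eq_iff.1 (Eq.trans (Eq.symm h) h')

theorem joins_src_tgt (G : Multigraph V E) (d : Dart E) : G.Joins d.1 (G.src d) (G.tgt d) := by
  obtain ⟨e, b⟩ := d
  cases b <;> simp [Joins, src, tgt, Sym2.eq_swap]

theorem Joins.exists_dart {G : Multigraph V E} {e : E} {u v : V} (h : G.Joins e u v) :
    ∃ b, G.src (e, b) = u ∧ G.tgt (e, b) = v := by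
  rcases (G.joins_src_tgt (e, true)).ends_eq h with h' | h'
  · exact ⟨true, h'⟩
  · exact ⟨false, by simpa [src, tgt] using h'.symm⟩

/-- The position of a vertex after the vertices outside `S` have been identified with the root. -/
noncomputable def posIn (pos : V → ℕ) (S : Finset V) (v : V) : ℕ := if v ∈ S then pos v else 0

/-- The graph with edge set `A` in which the vertices outside `S` have been identified with the
root is drawn without crossings below a line on which the vertices are placed according to `pos`,
and the edges of `T` join the vertices in `S` to their last neighbours among those before them. -/
structure IsOuterOrder (G : Multigraph V E) (T : Set (Dart E)) (pos : V → ℕ) (S : Finset V)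
    (A : Finset E) : Prop where
  inj : Function.Injective pos
  pos_pos : ∀ v ∈ S, 0 < pos v
  noncrossing : ∀ e ∈ A, ∀ f ∈ A, ∀ a b c d, G.Joins e a c → G.Joins f b d →
    posIn pos S a < posIn pos S b → posIn pos S b < posIn pos S c → ¬ posIn pos S c < posIn pos S d
  tree_inj : Set.InjOn G.tgt T
  tree_exists : ∀ v ∈ S, ∃ d ∈ T, G.tgt d = v
  tree_mem : ∀ d ∈ T, G.tgt d ∈ S → d.1 ∈ A
  tree_lt : ∀ d ∈ T, G.tgt d ∈ S → posIn pos S (G.src d) < pos (G.tgt d)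
  tree_max : ∀ d ∈ T, G.tgt d ∈ S → ∀ e ∈ A, ∀ x, G.Joins e (G.tgt d) x →
    posIn pos S x < pos (G.tgt d) → posIn pos S x ≤ posIn pos S (G.src d)

/-- The number of edges in `A` that join `u` to a vertex outside `U`. -/
noncomputable def outDeg (G : Multigraph V E) (A : Finset E) (U : Set V) (u : V) : ℕ :=
  (A.filter fun e => ∃ v ∉ U, G.Joins e u v).card

/-- Subparking functions of the graph with edge set `A` in which the vertices outside `S` have been
identified with the root, extended by zero. -/
def subpark (G : Multigraph V E) (pos : V → ℕ) (S : Finset V) (A : Finset E) : Set (V → ℤ) :=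
  {c | (∀ v ∉ S, c v = 0) ∧ ∀ U : Set V, U.Nonempty → U ⊆ S →
    ∃ u ∈ U, 0 ≤ c u ∧ c u < G.outDeg A U u - if (∀ v ∈ U, pos u ≤ pos v) then 1 else 0}

/-- `e` is an edge outside the tree that joins `w ∈ S` to a vertex outside `S`. -/
structure IsRootEdge (G : Multigraph V E) (T : Set (Dart E)) (S : Finset V) (A : Finset E)
    (e : E) (w : V) : Prop where
  mem : e ∈ A
  head : w ∈ S
  tail : ∃ x ∉ S, G.Joins e w x
  not_tree : ∀ d ∈ T, G.tgt d = w → d.1 ≠ e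

variable {G : Multigraph V E} {T : Set (Dart E)} {pos : V → ℕ} {S : Finset V} {A : Finset E}
  {e : E} {w : V}

theorem IsRootEdge.ne_tree (h : G.IsRootEdge T S A e w) {d : Dart E} (hd : d ∈ T)
    (hS : G.tgt d ∈ S) : d.1 ≠ e := by
  rintro rfl
  obtain ⟨x, hx, hj⟩ := h.tail
  rcases (G.joins_src_tgt d).ends_eq hj with h' | h'
  · exact hx (h'.2 ▸ hS)
  · exact h.not_tree d hd h'.2 rfl

theorem IsOuterOrder.erase_edge (h : G.IsOuterOrder T pos S A) (he : G.IsRootEdge T S A e w) :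
    G.IsOuterOrder T pos S (A.erase e) where
  inj := h.inj
  pos_pos := h.pos_pos
  noncrossing := fun f hf g hg => h.noncrossing f (Finset.mem_of_mem_erase hf) g
    (Finset.mem_of_mem_erase hg)
  tree_inj := h.tree_inj
  tree_exists := h.tree_exists
  tree_mem := fun d hd hS => Finset.mem_erase.2 ⟨he.ne_tree hd hS, h.tree_mem d hd hS⟩
  tree_lt := h.tree_lt
  tree_max := fun d hd hS f hf => h.tree_max d hd hS f (Finset.mem_of_mem_erase hf)

theorem IsOuterOrder.eq_empty_of_card_eq_zero (h : G.IsOuterOrder T pos S A) (hA : A.card = 0) :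
    S = ∅ := by
  by_contra hS
  obtain ⟨v, hv⟩ := Finset.nonempty_of_ne_empty hS
  obtain ⟨d, hd, rfl⟩ := h.tree_exists v hv
  have := h.tree_mem d hd hv
  rw [Finset.card_eq_zero.1 hA] at this
  simp at this

theorem posIn_of_mem {v : V} (hv : v ∈ S) : posIn pos S v = pos v := if_pos hv

theorem posIn_of_notMem {v : V} (hv : v ∉ S) : posIn pos S v = 0 := if_neg hv

theorem posIn_erase_self : posIn pos (S.erase w) w = 0 := posIn_of_notMem (by simp)

theorem posIn_erase_of_ne {v : V} (hv : v ≠ w) : posIn pos (S.erase w) v = posIn pos S v := by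
  simp [posIn, hv]

theorem posIn_erase_le (v : V) : posIn pos (S.erase w) v ≤ posIn pos S v := by
  by_cases hv : v = w
  · subst hv; rw [posIn_erase_self]; exact Nat.zero_le _
  · rw [posIn_erase_of_ne hv]

theorem mem_of_posIn_pos {v : V} (hv : 0 < posIn pos S v) : v ∈ S := by
  by_contra h
  rw [posIn_of_notMem h] at hv
  exact lt_irrefl _ hv

/-- Contraction moves `w` to position zero. The contracted edge runs from position zero to `w`, so
anything that becomes a crossing afterwards already crossed that edge or another one before. -/
theorem IsOuterOrder.contract (h : G.IsOuterOrder T pos S A) (he : G.IsRootEdge T S A e w) :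
    G.IsOuterOrder T pos (S.erase w) (A.erase e) where
  inj := h.inj
  pos_pos := fun v hv => h.pos_pos v (Finset.mem_of_mem_erase hv)
  noncrossing := by
    intro f hf g hg a b c d hac hbd hab hbc hcd
    obtain ⟨x, hx, hj⟩ := he.tail
    have hb := mem_of_posIn_pos (by omega : 0 < posIn pos (S.erase w) b)
    have hc := mem_of_posIn_pos (by omega : 0 < posIn pos (S.erase w) c)
    have hd := mem_of_posIn_pos (by omega : 0 < posIn pos (S.erase w) d)
    have hbw := Finset.ne_of_mem_erase hb
    have hcw := Finset.ne_of_mem_erase hc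
    have hdw := Finset.ne_of_mem_erase hd
    rw [posIn_erase_of_ne hcw, posIn_erase_of_ne hdw] at hcd
    rw [posIn_erase_of_ne hbw, posIn_erase_of_ne hcw] at hbc
    have hf := Finset.mem_of_mem_erase hf
    have hg := Finset.mem_of_mem_erase hg
    by_cases haw : a = w
    · subst haw
      rw [posIn_erase_self, posIn_erase_of_ne hbw] at hab
      have hx0 : posIn pos S x = 0 := posIn_of_notMem hx
      have key : ∀ y ∈ S, y ≠ a → posIn pos S y ≠ posIn pos S a := fun y hy hya hya' => by
        rw [posIn_of_mem hy, posIn_of_mem he.head] at hya'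
        exact hya (h.inj hya')
      have hb' := key b (Finset.mem_of_mem_erase hb) hbw
      have hd' := key d (Finset.mem_of_mem_erase hd) hdw
      -- Only the smallest endpoint `a` can be at the root. If `a = w` and `b` came before `w`, then
      -- either `d` also came before `w` and the two edges crossed with their roles exchanged, or
      -- `d` came after `w` and `g` crossed `e`.
      rcases lt_or_gt_of_ne hb' with h1 | h1
      · rcases lt_or_gt_of_ne hd' with h2 | h2
        · exact h.noncrossing g hg f hf b c d a hbd hac.symm hbc hcd h2
        · exact h.noncrossing e he.mem g hg x b a d hj.symm hbd (by omega) h1 h2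
      · exact h.noncrossing f hf g hg a b c d hac hbd h1 hbc hcd
    · rw [posIn_erase_of_ne haw, posIn_erase_of_ne hbw] at hab
      exact h.noncrossing f hf g hg a b c d hac hbd hab hbc hcd
  tree_inj := h.tree_inj
  tree_exists := fun v hv => h.tree_exists v (Finset.mem_of_mem_erase hv)
  tree_mem := fun d hd hS => Finset.mem_erase.2
    ⟨he.ne_tree hd (Finset.mem_of_mem_erase hS), h.tree_mem d hd (Finset.mem_of_mem_erase hS)⟩
  tree_lt := fun d hd hS =>
    (posIn_erase_le _).trans_lt (h.tree_lt d hd (Finset.mem_of_mem_erase hS))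
  tree_max := by
    intro d hd hS f hf x hj hx
    have hdS := Finset.mem_of_mem_erase hS
    have hdw := Finset.ne_of_mem_erase hS
    have hf := Finset.mem_of_mem_erase hf
    by_cases hxw : x = w
    · subst hxw; rw [posIn_erase_self]; exact Nat.zero_le _
    rw [posIn_erase_of_ne hxw] at hx ⊢
    have hle := h.tree_max d hd hdS f hf x hj hx
    by_cases hp : G.src d = w
    -- The tree parent `w` has become the root, so no earlier neighbour `x` may remain in `S`. Such
    -- an `x` would lie before `w`, and its edge to the head would cross `e`.
    · obtain ⟨y, hy, hyj⟩ := he.tail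
      have hlt := h.tree_lt d hd hdS
      rw [hp] at hle hlt ⊢
      rw [posIn_erase_self]
      by_contra hpos
      have hxS : x ∈ S := mem_of_posIn_pos (by omega : 0 < posIn pos S x)
      have hne : posIn pos S x ≠ posIn pos S w := fun h' => by
        rw [posIn_of_mem hxS, posIn_of_mem he.head] at h'
        exact hxw (h.inj h')
      refine h.noncrossing e he.mem f hf y x w (G.tgt d) hyj.symm hj.symm ?_ (by omega) ?_
      · rw [posIn_of_notMem hy]; omega
      · rwa [posIn_of_mem hdS]
    · rwa [posIn_erase_of_ne hp]

/-- The far end of `e` is outside `S`, so `e` leaves every `U ⊆ S` containing `w`, and only at `w`.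
-/
theorem IsRootEdge.outDeg_eq (he : G.IsRootEdge T S A e w) {U : Set V} (hU : U ⊆ S) {u : V}
    (hu : u ∈ U) : G.outDeg A U u = G.outDeg (A.erase e) U u + if u = w then 1 else 0 := by
  obtain ⟨x, hx, hj⟩ := he.tail
  unfold outDeg
  rw [Finset.filter_erase]
  split_ifs with h
  · subst h
    rw [Finset.card_erase_add_one]
    exact Finset.mem_filter.2 ⟨he.mem, x, fun hxU => hx (hU hxU), hj⟩
  · rw [Finset.erase_eq_of_notMem, add_zero]
    rintro hmem
    obtain ⟨-, v, hv, hj'⟩ := Finset.mem_filter.1 hmem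
    rcases hj'.ends_eq hj with h' | h'
    · exact h h'.1
    · exact hx (h'.1 ▸ hU hu)

theorem subpark_nonneg {c : V → ℤ} (hc : c ∈ G.subpark pos S A) (v : V) : 0 ≤ c v := by
  by_cases hv : v ∈ S
  · obtain ⟨u, hu, h0, -⟩ := hc.2 {v} ⟨v, rfl⟩ (by simpa using hv)
    rwa [← Set.mem_singleton_iff.1 hu]
  · exact (hc.1 v hv).ge

theorem subpark_le {c : V → ℤ} (hc : c ∈ G.subpark pos S A) (v : V) : c v ≤ A.card := by
  by_cases hv : v ∈ S
  · obtain ⟨u, hu, -, h1⟩ := hc.2 {v} ⟨v, rfl⟩ (by simpa using hv)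
    rw [Set.mem_singleton_iff] at hu
    subst hu
    have h2 : G.outDeg A {u} u ≤ A.card := Finset.card_filter_le _ _
    split_ifs at h1 <;> omega
  · rw [hc.1 v hv]; positivity

theorem subpark_finite [Fintype V] : (G.subpark pos S A).Finite := by
  refine (Set.finite_Icc (0 : V → ℤ) (fun _ => (A.card : ℤ))).subset fun c hc => ?_
  exact ⟨fun v => subpark_nonneg hc v, fun v => subpark_le hc v⟩

/-- Sets that avoid `w` impose the same condition on both sides. A set containing `w` is served by
`u = w` with value zero: besides `e` there is the tree edge of `w`, which also leaves the set if `w`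
is its first vertex. -/
theorem IsRootEdge.mem_subpark_contract_iff (h : G.IsOuterOrder T pos S A)
    (he : G.IsRootEdge T S A e w) (c : V → ℤ) :
    c ∈ G.subpark pos (S.erase w) (A.erase e) ↔ c ∈ G.subpark pos S A ∧ c w = 0 := by
  constructor
  · rintro ⟨h0, h1⟩
    have hw : c w = 0 := h0 w (by simp)
    refine ⟨⟨fun v hv => h0 v fun hv' => hv (Finset.mem_of_mem_erase hv'), fun U hU hUS => ?_⟩, hw⟩
    by_cases hwU : w ∈ U
    · refine ⟨w, hwU, hw.ge, ?_⟩
      rw [hw, he.outDeg_eq hUS hwU, if_pos rfl]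
      split_ifs with hmin
      · obtain ⟨d, hd, hdw⟩ := h.tree_exists w he.head
        have hdS : G.tgt d ∈ S := hdw ▸ he.head
        have hlt := h.tree_lt d hd hdS
        have : 0 < G.outDeg (A.erase e) U w := by
          refine Finset.card_pos.2 ⟨d.1, Finset.mem_filter.2 ⟨Finset.mem_erase.2
            ⟨he.ne_tree hd hdS, h.tree_mem d hd hdS⟩, G.src d, fun hsU => ?_,
            hdw ▸ (G.joins_src_tgt d).symm⟩⟩
          have := hmin _ hsU
          rw [posIn_of_mem (hUS hsU), hdw] at hlt
          omega
        push_cast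
        omega
      · push_cast
        omega
    · obtain ⟨u, hu, hu0, hu1⟩ := h1 U hU fun v hv => by
        exact Finset.mem_erase.2 ⟨fun hvw => hwU (hvw ▸ hv), hUS hv⟩
      refine ⟨u, hu, hu0, ?_⟩
      rwa [he.outDeg_eq hUS hu, if_neg fun huw : u = w => hwU (huw ▸ hu), add_zero]
  · rintro ⟨⟨h0, h1⟩, hw⟩
    refine ⟨fun v hv => ?_, fun U hU hUS => ?_⟩
    · by_cases hvw : v = w
      · rw [hvw, hw]
      · exact h0 v fun hv' => hv (Finset.mem_erase.2 ⟨hvw, hv'⟩)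
    · have hUS' : U ⊆ S := fun v hv => Finset.mem_of_mem_erase (hUS hv)
      obtain ⟨u, hu, hu0, hu1⟩ := h1 U hU hUS'
      refine ⟨u, hu, hu0, ?_⟩
      rwa [he.outDeg_eq hUS' hu, if_neg (Finset.ne_of_mem_erase (hUS hu)), add_zero] at hu1

/-- Removing `e` lowers the bound at `w` by one for every set containing `w`, which matches lowering
the value at `w` by one. -/
theorem IsRootEdge.mem_subpark_erase_iff (he : G.IsRootEdge T S A e w) (c : V → ℤ) :
    c ∈ G.subpark pos S (A.erase e) ↔
      (c + Pi.single w (1 : ℤ) : V → ℤ) ∈ G.subpark pos S A ∧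
        1 ≤ (c + Pi.single w (1 : ℤ) : V → ℤ) w := by
  have hsingle : ∀ v, (c + Pi.single w (1 : ℤ) : V → ℤ) v = c v + if v = w then 1 else 0 := fun v => by
    simp [Pi.single_apply]
  constructor
  · intro hc
    refine ⟨⟨fun v hv => ?_, fun U hU hUS => ?_⟩, ?_⟩
    · rw [hsingle, hc.1 v hv, if_neg fun hvw : v = w => hv (hvw ▸ he.head), add_zero]
    · obtain ⟨u, hu, hu0, hu1⟩ := hc.2 U hU hUS
      refine ⟨u, hu, ?_, ?_⟩ <;> rw [hsingle]
      · split_ifs <;> omega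
      · rw [he.outDeg_eq hUS hu]
        push_cast
        linarith
    · rw [hsingle, if_pos rfl]
      linarith [subpark_nonneg hc w]
  · rintro ⟨hc, hw⟩
    refine ⟨fun v hv => ?_, fun U hU hUS => ?_⟩
    · have := hc.1 v hv
      rwa [hsingle, if_neg fun hvw : v = w => hv (hvw ▸ he.head), add_zero] at this
    · obtain ⟨u, hu, hu0, hu1⟩ := hc.2 U hU hUS
      rw [he.outDeg_eq hUS hu] at hu1
      rw [hsingle] at hu0 hu1 hw
      refine ⟨u, hu, ?_, ?_⟩
      · by_cases huw : u = w
        · rw [huw]; rw [if_pos rfl] at hw; linarith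
        · rwa [if_neg huw, add_zero] at hu0
      · push_cast at hu1
        linarith

theorem IsRootEdge.subpark_eq (h : G.IsOuterOrder T pos S A) (he : G.IsRootEdge T S A e w) :
    G.subpark pos S A = (fun c : V → ℤ => c + Pi.single w 1) '' G.subpark pos S (A.erase e) ∪
      G.subpark pos (S.erase w) (A.erase e) := by
  ext c
  rw [Set.mem_union, he.mem_subpark_contract_iff h, Set.mem_image]
  constructor
  · intro hc
    rcases (subpark_nonneg hc w).eq_or_lt with hw | hw
    · exact Or.inr ⟨hc, hw.symm⟩
    · refine Or.inl ⟨c - Pi.single w 1, ?_, sub_add_cancel _ _⟩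
      rw [he.mem_subpark_erase_iff, sub_add_cancel]
      exact ⟨hc, hw⟩
  · rintro (⟨c, hc, rfl⟩ | hc)
    · exact ((he.mem_subpark_erase_iff c).1 hc).1
    · exact hc.1

theorem IsRootEdge.subpark_disjoint (h : G.IsOuterOrder T pos S A) (he : G.IsRootEdge T S A e w) :
    Disjoint ((fun c : V → ℤ => c + Pi.single w 1) '' G.subpark pos S (A.erase e))
      (G.subpark pos (S.erase w) (A.erase e)) := by
  rw [Set.disjoint_left]
  rintro _ ⟨c, hc, rfl⟩ hc'
  have h1 := ((he.mem_subpark_erase_iff c).1 hc).2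
  have h2 := ((he.mem_subpark_contract_iff h _).1 hc').2
  simp only at h2
  omega

/-- If no edge outside the tree joins `S` to its complement, then there is a bridge. -/
theorem IsOuterOrder.exists_bridge (h : G.IsOuterOrder T pos S A) (hS : S.Nonempty)
    (hno : ∀ e w, ¬ G.IsRootEdge T S A e w) :
    ∃ e ∈ A, ∃ w ∈ S, ∃ x ∉ S, G.Joins e w x ∧ ∃ X : Set V, X ⊆ S ∧ w ∈ X ∧
      (∀ v ∈ X, pos w ≤ pos v) ∧
      ∀ f ∈ A, ∀ v ∈ X, ∀ y ∉ X, G.Joins f v y → f = e ∧ v = w := by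
  -- By assumption, every edge leaving `S` is the tree edge of its end in `S`.
  have hedge : ∀ f ∈ A, ∀ v ∈ S, ∀ y ∉ S, G.Joins f v y → ∃ d ∈ T, G.tgt d = v ∧ d.1 = f := by
    intro f hf v hv y hy hj
    by_contra! hcon
    exact hno f v ⟨hf, hv, ⟨y, hy, hj⟩, hcon⟩
  let N := S.filter fun v => ∃ f ∈ A, ∃ y ∉ S, G.Joins f v y
  have hN : N.Nonempty := by
    obtain ⟨v, hv, hmin⟩ := S.exists_min_image pos hS
    obtain ⟨d, hd, rfl⟩ := h.tree_exists v hv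
    refine ⟨G.tgt d, Finset.mem_filter.2 ⟨hv, d.1, h.tree_mem d hd hv, G.src d, fun hs => ?_,
      (G.joins_src_tgt d).symm⟩⟩
    have h1 := h.tree_lt d hd hv
    have h2 := hmin _ hs
    rw [posIn_of_mem hs] at h1
    omega
  -- The last vertex `w` adjacent to the root cuts off the set of all vertices from `w` on, and its
  -- tree edge `e` is the bridge.
  obtain ⟨w, hw, hmax⟩ := N.exists_max_image pos hN
  obtain ⟨hwS, e, he, x, hx, hj⟩ := Finset.mem_filter.1 hw
  obtain ⟨d, hd, hdw, hde⟩ := hedge e he w hwS x hx hj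
  refine ⟨e, he, w, hwS, x, hx, hj, {v | v ∈ S ∧ pos w ≤ pos v}, fun v hv => hv.1,
    ⟨hwS, le_rfl⟩, fun v hv => hv.2, ?_⟩
  rintro f hf v ⟨hvS, hv⟩ y hy hfj
  -- An edge from this set to an earlier vertex of `S` would cross `e` if it started after `w`; if
  -- it started at `w`, the tree parent of `w` would not be its last earlier neighbour.
  by_cases hyS : y ∈ S
  · exfalso
    have hyw : pos y < pos w := by
      by_contra hcon
      exact hy ⟨hyS, not_lt.1 hcon⟩
    have hy0 := h.pos_pos y hyS
    have hx0 : posIn pos S x = 0 := posIn_of_notMem hx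
    rcases hv.eq_or_lt with hvw | hvw
    · have := h.inj hvw
      subst this
      have hsrc : posIn pos S (G.src d) = 0 := by
        rcases (hde ▸ G.joins_src_tgt d).ends_eq hj with h' | h'
        · exact absurd (h'.2 ▸ hdw ▸ hwS) hx
        · rw [h'.1, hx0]
      have := h.tree_max d hd (hdw ▸ hwS) f hf y (hdw ▸ hfj)
        (by rwa [posIn_of_mem hyS, hdw])
      rw [hsrc, posIn_of_mem hyS] at this
      omega
    · refine h.noncrossing e he f hf x y w v hj.symm hfj.symm ?_ ?_ ?_
      · rwa [hx0, posIn_of_mem hyS]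
      · rwa [posIn_of_mem hyS, posIn_of_mem hwS]
      · rwa [posIn_of_mem hvS, posIn_of_mem hwS]
  · have hvN : v ∈ N := Finset.mem_filter.2 ⟨hvS, f, hf, y, hyS, hfj⟩
    have hvw : v = w := h.inj (le_antisymm (hmax v hvN) hv)
    subst hvw
    obtain ⟨d', hd', hdv', hdf'⟩ := hedge f hf v hvS y hyS hfj
    have := h.tree_inj hd hd' (hdw.trans hdv'.symm)
    subst this
    exact ⟨hdf'.symm.trans hde, rfl⟩

/-- The set `X` admits no witness: only its first vertex `w` has an edge leaving `X`, only one such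
edge, and that one is discounted. -/
theorem subpark_eq_empty_of_bridge {X : Set V} (hXS : X ⊆ S) (hw : w ∈ X)
    (hmin : ∀ v ∈ X, pos w ≤ pos v)
    (hX : ∀ f ∈ A, ∀ v ∈ X, ∀ y ∉ X, G.Joins f v y → f = e ∧ v = w) :
    G.subpark pos S A = ∅ := by
  ext c
  simp only [Set.mem_empty_iff_false, iff_false]
  intro hc
  obtain ⟨u, hu, hu0, hu1⟩ := hc.2 X ⟨w, hw⟩ hXS
  by_cases huw : u = w
  · subst huw
    rw [if_pos hmin] at hu1
    have : G.outDeg A X u ≤ 1 := by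
      refine Finset.card_le_one.2 fun f hf g hg => ?_
      obtain ⟨hf, y, hy, hj⟩ := Finset.mem_filter.1 hf
      obtain ⟨hg, z, hz, hk⟩ := Finset.mem_filter.1 hg
      exact (hX f hf u hu y hy hj).1.trans (hX g hg u hu z hz hk).1.symm
    omega
  · have : G.outDeg A X u = 0 := by
      refine Finset.card_eq_zero.2 (Finset.filter_eq_empty_iff.2 ?_)
      rintro f hf ⟨y, hy, hj⟩
      exact huw (hX f hf u hu y hy hj).2
    split_ifs at hu1 <;> omega

theorem subpark_empty : G.subpark pos ∅ A = {0} := by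
  ext c
  constructor
  · exact fun hc => funext fun v => hc.1 v (by simp)
  · rintro rfl
    refine ⟨fun _ _ => rfl, fun U ⟨u, hu⟩ hU => ?_⟩
    simpa using hU hu

/-! ### Internal partial orientations under deletion and contraction -/

/-- A partial orientation of the graph with edge set `A` in which the vertices outside `S` have been
identified with the root: it is acyclic, every vertex in `S` can be reached from the root, and the
tree edge to the first vertex of a set which no oriented edge leaves is neutral. -/
structure IsInternal (G : Multigraph V E) (T : Set (Dart E)) (pos : V → ℕ) (S : Finset V)
    (A : Finset E) (O : Set (Dart E)) : Prop where
  partialOrientation : IsPartialOrientation O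
  mem : ∀ d ∈ O, d.1 ∈ A
  tgt_mem : ∀ d ∈ O, G.tgt d ∈ S
  height : ∃ ρ : V → ℕ, ∀ d ∈ O, G.src d ∈ S → ρ (G.src d) < ρ (G.tgt d)
  reach : ∀ v ∈ S, ∃ d ∈ O, G.tgt d = v
  neutral : ∀ U : Set V, U ⊆ S → (∀ d ∈ O, G.src d ∈ U → G.tgt d ∈ U) → ∀ d ∈ T, G.tgt d ∈ U →
    (∀ v ∈ U, pos (G.tgt d) ≤ pos v) → IsNeutral O d.1

theorem isPartialOrientation_insert {O : Set (Dart E)} (hO : IsPartialOrientation O) {e : E}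
    (he : ∀ d ∈ O, d.1 ≠ e) (b : Bool) : IsPartialOrientation (insert (e, b) O) := by
  rintro f ⟨h1, h2⟩
  rcases h1 with h1 | h1 <;> rcases h2 with h2 | h2
  · rw [Prod.mk.injEq] at h1 h2
    exact absurd (h1.2.trans h2.2.symm) (by simp)
  · exact he _ h2 (Prod.mk.inj h1).1
  · exact he _ h1 (Prod.mk.inj h2).1
  · exact hO f ⟨h1, h2⟩

theorem isNeutral_insert {O : Set (Dart E)} {e f : E} (hO : IsNeutral O f) (h : f ≠ e) (b : Bool) :
    IsNeutral (insert (e, b) O) f := by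
  rintro b' (h' | h')
  · exact h (Prod.mk.inj h').1
  · exact hO b' h'

theorem IsRootEdge.isInternal_insert_erase (he : G.IsRootEdge T S A e w) {O : Set (Dart E)}
    (hO : G.IsInternal T pos S (A.erase e) O) {b : Bool} (hb : G.tgt (e, b) = w)
    (hs : G.src (e, b) ∉ S) : G.IsInternal T pos S A (insert (e, b) O) where
  partialOrientation := isPartialOrientation_insert hO.partialOrientation
    (fun d hd => Finset.ne_of_mem_erase (hO.mem d hd)) b
  mem := by
    rintro d (rfl | hd)
    · exact he.mem
    · exact Finset.mem_of_mem_erase (hO.mem d hd)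
  tgt_mem := by
    rintro d (rfl | hd)
    · exact hb ▸ he.head
    · exact hO.tgt_mem d hd
  height := by
    obtain ⟨ρ, hρ⟩ := hO.height
    refine ⟨ρ, ?_⟩
    rintro d (rfl | hd) hd'
    · exact absurd hd' hs
    · exact hρ d hd hd'
  reach := fun v hv => by
    obtain ⟨d, hd, h⟩ := hO.reach v hv
    exact ⟨d, Or.inr hd, h⟩
  neutral := fun U hU hcl d hd hdU hmin => isNeutral_insert
    (hO.neutral U hU (fun d' hd' => hcl d' (Or.inr hd')) d hd hdU hmin)
    (he.ne_tree hd (hU hdU)) b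

/-- After the contraction no oriented edge has head `w`, so `(e, b)` becomes the only edge entering
`w`. This matches the value zero at `w`. -/
theorem IsRootEdge.isInternal_insert_contract (h : G.IsOuterOrder T pos S A)
    (he : G.IsRootEdge T S A e w) {O : Set (Dart E)}
    (hO : G.IsInternal T pos (S.erase w) (A.erase e) O) {b : Bool} (hb : G.tgt (e, b) = w)
    (hs : G.src (e, b) ∉ S) : G.IsInternal T pos S A (insert (e, b) O) where
  partialOrientation := isPartialOrientation_insert hO.partialOrientation
    (fun d hd => Finset.ne_of_mem_erase (hO.mem d hd)) b
  mem := by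
    rintro d (rfl | hd)
    · exact he.mem
    · exact Finset.mem_of_mem_erase (hO.mem d hd)
  tgt_mem := by
    rintro d (rfl | hd)
    · exact hb ▸ he.head
    · exact Finset.mem_of_mem_erase (hO.tgt_mem d hd)
  height := by
    obtain ⟨ρ, hρ⟩ := hO.height
    -- Inside `S` the vertex `w` is a source, so it can be placed below all others.
    refine ⟨fun v => if v = w then 0 else ρ v + 1, ?_⟩
    rintro d (rfl | hd) hd'
    · exact absurd hd' hs
    · have h1 := Finset.ne_of_mem_erase (hO.tgt_mem d hd)
      simp only [if_neg h1]
      split_ifs with h2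
      · omega
      · have := hρ d hd (Finset.mem_erase.2 ⟨h2, hd'⟩)
        omega
  reach := fun v hv => by
    by_cases hvw : v = w
    · exact ⟨(e, b), Or.inl rfl, hb.trans hvw.symm⟩
    · obtain ⟨d, hd, h⟩ := hO.reach v (Finset.mem_erase.2 ⟨hvw, hv⟩)
      exact ⟨d, Or.inr hd, h⟩
  neutral := fun U hU hcl d hd hdU hmin => by
    have hne : ∀ d' ∈ O, G.tgt d' ≠ w := fun d' hd' => Finset.ne_of_mem_erase (hO.tgt_mem d' hd')
    refine isNeutral_insert ?_ (he.ne_tree hd (hU hdU)) b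
    -- If `w` is the first vertex of `U`, its tree edge is not oriented into `w`, and the opposite
    -- orientation would bring the earlier tree parent into `U`. Otherwise `w` can be dropped from
    -- `U`, which stays closed.
    by_cases hdw : G.tgt d = w
    · intro b' hb'
      have hj := G.joins_src_tgt d
      rcases (G.joins_src_tgt (d.1, b')).ends_eq hj with h' | h'
      · exact hne _ hb' (h'.2.trans hdw)
      · have h1 : G.src d ∈ U := h'.2 ▸ hcl _ (Or.inr hb') (h'.1 ▸ hdU)
        have h2 := h.tree_lt d hd (hU hdU)
        have h3 := hmin _ h1
        rw [posIn_of_mem (hU h1)] at h2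
        omega
    · refine hO.neutral (U \ {w}) (fun v hv => Finset.mem_erase.2 ⟨hv.2, hU hv.1⟩)
        (fun d' hd' hs' => ⟨hcl d' (Or.inr hd') hs'.1, hne d' hd'⟩) d hd ⟨hdU, hdw⟩
        fun v hv => hmin v hv.1

theorem ncard_indeg_insert [Fintype E] {O : Set (Dart E)} {b : Bool} (he : ∀ d ∈ O, d.1 ≠ e)
    (hb : G.tgt (e, b) = w) (v : V) : {d ∈ insert (e, b) O | G.tgt d = v}.ncard =
      {d ∈ O | G.tgt d = v}.ncard + if v = w then 1 else 0 := by
  split_ifs with h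
  · rw [← Set.ncard_insert_of_notMem (a := (e, b)) (fun h' => he _ h'.1 rfl) (Set.toFinite _)]
    congr 1
    ext d
    simp only [Set.mem_insert_iff, Set.mem_ofPred_eq]
    constructor
    · rintro ⟨h1 | h1, h2⟩
      · exact Or.inl h1
      · exact Or.inr ⟨h1, h2⟩
    · rintro (h1 | h1)
      · exact ⟨Or.inl h1, by rw [h1, hb, h]⟩
      · exact ⟨Or.inr h1.1, h1.2⟩
  · rw [add_zero]
    congr 1
    ext d
    simp only [Set.mem_insert_iff, Set.mem_ofPred_eq]
    constructor
    · rintro ⟨h1 | h1, h2⟩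
      · exact absurd (by rw [← h2, h1, hb]) h
      · exact ⟨h1, h2⟩
    · exact fun h1 => ⟨Or.inr h1.1, h1.2⟩

/-- Follows the recursion `IsRootEdge.subpark_eq`, each time adding the removed edge oriented away
from the root; a bridge leaves nothing to prove. -/
theorem IsOuterOrder.exists_isInternal [Fintype E] (h : G.IsOuterOrder T pos S A) {c : V → ℤ}
    (hc : c ∈ G.subpark pos S A) : ∃ O, G.IsInternal T pos S A O ∧
      ∀ v ∈ S, c v = ({d ∈ O | G.tgt d = v}.ncard : ℤ) - 1 := by
  induction hn : A.card generalizing S A c with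
  | zero =>
    obtain rfl := h.eq_empty_of_card_eq_zero hn
    refine ⟨∅, ⟨by simp [IsPartialOrientation], by simp, by simp, ⟨fun _ => 0, by simp⟩, by simp,
      fun U hU _ d _ hdU => ?_⟩, by simp⟩
    simpa using hU hdU
  | succ n ih =>
    by_cases hex : ∃ e w, G.IsRootEdge T S A e w
    · obtain ⟨e, w, he⟩ := hex
      obtain ⟨x, hx, hj⟩ := he.tail
      obtain ⟨b, hb1, hb2⟩ := hj.symm.exists_dart
      have hcard : (A.erase e).card = n := by rw [Finset.card_erase_of_mem he.mem, hn]; rfl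
      rw [he.subpark_eq h] at hc
      rcases hc with ⟨c, hc, rfl⟩ | hc
      · obtain ⟨O, hO, hOc⟩ := ih (h.erase_edge he) hc hcard
        refine ⟨insert (e, b) O, he.isInternal_insert_erase hO hb2 (hb1 ▸ hx), fun v hv => ?_⟩
        rw [ncard_indeg_insert (fun d hd => Finset.ne_of_mem_erase (hO.mem d hd)) hb2]
        simp only [Pi.add_apply, Pi.single_apply, hOc v hv]
        push_cast
        ring
      · obtain ⟨O, hO, hOc⟩ := ih (h.contract he) hc hcard
        refine ⟨insert (e, b) O, he.isInternal_insert_contract h hO hb2 (hb1 ▸ hx), fun v hv => ?_⟩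
        rw [ncard_indeg_insert (fun d hd => Finset.ne_of_mem_erase (hO.mem d hd)) hb2]
        by_cases hvw : v = w
        · have : {d ∈ O | G.tgt d = v} = ∅ := by
            ext d
            simp only [Set.mem_ofPred_eq, Set.mem_empty_iff_false, iff_false, not_and]
            exact fun hd hdv => Finset.ne_of_mem_erase (hO.tgt_mem d hd) (hdv.trans hvw)
          rw [this, hc.1 v (by simp [hvw])]
          simp [hvw]
        · rw [hOc v (Finset.mem_erase.2 ⟨hvw, hv⟩)]
          simp [hvw]
    · push Not at hex
      rcases S.eq_empty_or_nonempty with rfl | hS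
      · refine ⟨∅, ⟨by simp [IsPartialOrientation], by simp, by simp, ⟨fun _ => 0, by simp⟩,
          by simp, fun U hU _ d _ hdU => ?_⟩, by simp⟩
        simpa using hU hdU
      · obtain ⟨e, -, w, -, x, -, -, X, hXS, hwX, hmin, hX⟩ := h.exists_bridge hS hex
        rw [subpark_eq_empty_of_bridge hXS hwX hmin hX] at hc
        exact absurd hc (Set.notMem_empty c)

end Multigraph

/-! ### The Tutte polynomial at `x = 0` under deletion and contraction -/

theorem natCard_quot_eq_of_eqvGen {α : Type*} {r s : α → α → Prop}
    (hrs : ∀ a b, r a b → Relation.EqvGen s a b) (hsr : ∀ a b, s a b → Relation.EqvGen r a b) :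
    Nat.card (Quot r) = Nat.card (Quot s) :=
  Nat.card_congr
    { toFun := Quot.lift (Quot.mk s) fun a b h => Quot.eqvGen_sound (hrs a b h)
      invFun := Quot.lift (Quot.mk r) fun a b h => Quot.eqvGen_sound (hsr a b h)
      left_inv := by rintro ⟨a⟩; rfl
      right_inv := by rintro ⟨a⟩; rfl }

/-- Joining two different classes reduces the number of classes by one. -/
theorem natCard_quot_join {α : Type*} [Finite α] {r : α → α → Prop} {a b : α}
    (h : ¬ Relation.EqvGen r a b) :
    Nat.card (Quot r) = Nat.card (Quot fun x y => r x y ∨ x = a ∧ y = b) + 1 := by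
  have hab : Quot.mk r a ≠ Quot.mk r b := fun h' => h (Quot.eqvGen_exact h')
  let s := fun x y => r x y ∨ x = a ∧ y = b
  -- The joined quotient is the old one without the class of `b`, which has been absorbed by the
  -- class of `a`.
  let φ : {x : Quot r // x ≠ Quot.mk r b} ≃ Quot s :=
    { toFun := fun x => Quot.lift (Quot.mk s) (fun x y h => Quot.sound (Or.inl h)) x.1
      invFun := Quot.lift
        (fun x => if hx : Quot.mk r x = Quot.mk r b then ⟨Quot.mk r a, hab⟩ else ⟨Quot.mk r x, hx⟩)
        (by
          rintro x y (hxy | ⟨rfl, rfl⟩)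
          · simp only [Quot.sound hxy]
          · simp [hab])
      left_inv := by
        rintro ⟨⟨x⟩, hx⟩
        exact dif_neg hx
      right_inv := by
        rintro ⟨x⟩
        by_cases hx : Quot.mk r x = Quot.mk r b
        · simp only [dif_pos hx]
          refine (Quot.sound (Or.inr ⟨rfl, rfl⟩) : Quot.mk s a = Quot.mk s b).trans ?_
          exact congrArg (Quot.lift (Quot.mk s) fun x y h => Quot.sound (Or.inl h)) hx.symm
        · simp only [dif_neg hx] }
  rw [← Nat.card_congr φ]
  have := Set.ncard_add_ncard_compl ({Quot.mk r b} : Set (Quot r))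
  rw [Set.ncard_singleton, add_comm] at this
  exact this.symm

namespace Multigraph

variable {V E : Type*} {G : Multigraph V E} {T : Set (Dart E)} {pos : V → ℕ} {S : Finset V}
  {A B : Finset E} {e : E} {w : V}

/-- The number of components of the graph with edge set `B` in which the vertices outside `S` have
been identified. -/
noncomputable def components (G : Multigraph V E) (S : Finset V) (B : Finset E) : ℕ :=
  Nat.card (Quot fun u v : V => (∃ e ∈ B, G.Joins e u v) ∨ (u ∉ S ∧ v ∉ S))

theorem components_insert (hw : w ∈ S) {x : V} (hx : x ∉ S) (hj : G.Joins e w x) :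
    G.components S (insert e B) = G.components (S.erase w) B := by
  have hedge : ∀ f ∈ B, ∀ u v, G.Joins f u v →
      (∃ e ∈ B, G.Joins e u v) ∨ (u ∉ S.erase w ∧ v ∉ S.erase w) :=
    fun f hf u v hj' => Or.inl ⟨f, hf, hj'⟩
  refine natCard_quot_eq_of_eqvGen (fun u v h => ?_) fun u v h => ?_
  · rcases h with ⟨f, hf, hj'⟩ | ⟨hu, hv⟩
    · rcases Finset.mem_insert.1 hf with rfl | hf
      · refine Relation.EqvGen.rel _ _ (Or.inr ?_)
        rcases hj'.ends_eq hj with ⟨rfl, rfl⟩ | ⟨rfl, rfl⟩ <;> simp [hx]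
      · exact Relation.EqvGen.rel _ _ (Or.inl ⟨f, hf, hj'⟩)
    · exact Relation.EqvGen.rel _ _ (Or.inr ⟨by simp [hu], by simp [hv]⟩)
  · rcases h with ⟨f, hf, hj'⟩ | ⟨hu, hv⟩
    · exact Relation.EqvGen.rel _ _ (Or.inl ⟨f, Finset.mem_insert_of_mem hf, hj'⟩)
    · have key : ∀ y, y ∉ S.erase w → Relation.EqvGen
          (fun u v : V => (∃ f ∈ insert e B, G.Joins f u v) ∨ (u ∉ S ∧ v ∉ S)) y x := by
        intro y hy
        by_cases hyw : y = w
        · exact Relation.EqvGen.rel _ _ (Or.inl ⟨e, by simp, hyw ▸ hj⟩)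
        · exact Relation.EqvGen.rel _ _ (Or.inr ⟨fun h => hy (Finset.mem_erase.2 ⟨hyw, h⟩), hx⟩)
      exact (key u hu).trans _ _ _ ((key v hv).symm _ _)

/-- No edge of `B` leaves `X`, so `w` is not connected to the root; identifying them merges two
different components. -/
theorem components_bridge [Finite V] {x : V} (hx : x ∉ S) {X : Set V} (hXS : X ⊆ S)
    (hwX : w ∈ X) (hX : ∀ f ∈ B, ∀ v ∈ X, ∀ y ∉ X, ¬ G.Joins f v y) :
    G.components S B = G.components (S.erase w) B + 1 := by
  have hne : ¬ Relation.EqvGen (fun u v : V => (∃ e ∈ B, G.Joins e u v) ∨ (u ∉ S ∧ v ∉ S)) w x := by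
    intro h
    have : ∀ u v, Relation.EqvGen
        (fun u v : V => (∃ e ∈ B, G.Joins e u v) ∨ (u ∉ S ∧ v ∉ S)) u v → (u ∈ X ↔ v ∈ X) := by
      intro u v h
      induction h with
      | rel u v h =>
        rcases h with ⟨f, hf, hj⟩ | ⟨hu, hv⟩
        · constructor
          · intro hu
            by_contra hv
            exact hX f hf u hu v hv hj
          · intro hv
            by_contra hu
            exact hX f hf v hv u hu hj.symm
        · exact iff_of_false (fun h => hu (hXS h)) fun h => hv (hXS h)
      | refl u => rfl
      | symm u v _ ih => exact ih.symm
      | trans u v w _ _ ih1 ih2 => exact ih1.trans ih2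
    exact hx (hXS ((this w x h).1 hwX))
  unfold components
  rw [natCard_quot_join hne]
  congr 1
  refine natCard_quot_eq_of_eqvGen (fun u v h => ?_) fun u v h => ?_
  · refine Relation.EqvGen.rel _ _ ?_
    rcases h with (h | ⟨hu, hv⟩) | ⟨rfl, rfl⟩
    · exact Or.inl h
    · exact Or.inr ⟨by simp [hu], by simp [hv]⟩
    · exact Or.inr ⟨by simp, by simp [hx]⟩
  · rcases h with h | ⟨hu, hv⟩
    · exact Relation.EqvGen.rel _ _ (Or.inl (Or.inl h))
    · have key : ∀ y, y ∉ S.erase w → Relation.EqvGen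
          (fun u v => ((∃ e ∈ B, G.Joins e u v) ∨ (u ∉ S ∧ v ∉ S)) ∨ u = w ∧ v = x) y x := by
        intro y hy
        by_cases hyw : y = w
        · exact Relation.EqvGen.rel _ _ (Or.inr ⟨hyw, rfl⟩)
        · exact Relation.EqvGen.rel _ _
            (Or.inl (Or.inr ⟨fun h => hy (Finset.mem_erase.2 ⟨hyw, h⟩), hx⟩))
      exact (key u hu).trans _ _ _ ((key v hv).symm _ _)

theorem components_pos [Finite V] [Nonempty V] : 0 < G.components S B := by
  have : Nonempty (Quot fun u v : V => (∃ e ∈ B, G.Joins e u v) ∨ (u ∉ S ∧ v ∉ S)) :=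
    ‹Nonempty V›.map (Quot.mk _)
  exact Nat.card_pos

theorem components_empty [Nonempty V] : G.components ∅ B = 1 := by
  rw [components, Nat.card_eq_one_iff_unique]
  refine ⟨⟨?_⟩, ‹Nonempty V›.map (Quot.mk _)⟩
  rintro ⟨u⟩ ⟨v⟩
  exact Quot.sound (Or.inr ⟨by simp, by simp⟩)

variable {R : Type*} [CommRing R]

/-- The value at `(0, t)` of the Tutte polynomial of the connected graph with edge set `A` in which
the vertices outside `S` have been identified. -/
noncomputable def tutteValue (G : Multigraph V E) (t : R) (S : Finset V) (A : Finset E) : R :=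
  ∑ B ∈ A.powerset, (-1) ^ (G.components S B - 1) *
    (t - 1) ^ (G.components S B + B.card - (S.card + 1))

/-- Edge sets without `e` give the deletion. In edge sets containing `e`, the edge has the same
effect as identifying `w` with the root, which gives the contraction. -/
theorem tutteValue_eq_add (t : R) (he : e ∈ A) (hw : w ∈ S) {x : V} (hx : x ∉ S)
    (hj : G.Joins e w x) : G.tutteValue t S A =
      G.tutteValue t S (A.erase e) + G.tutteValue t (S.erase w) (A.erase e) := by
  conv_lhs => rw [← Finset.insert_erase he]
  rw [tutteValue, Finset.sum_powerset_insert (Finset.notMem_erase e A)]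
  congr 1
  refine Finset.sum_congr rfl fun B hB => ?_
  have heB : e ∉ B := fun h => Finset.notMem_erase e A (Finset.mem_powerset.1 hB h)
  rw [components_insert hw hx hj, Finset.card_insert_of_notMem heB,
    ← Finset.card_erase_add_one hw]
  congr 2
  omega

/-- Deletion and contraction cancel term by term: without the bridge there is one more component,
which changes the sign, while the exponent of `t - 1` stays the same. -/
theorem tutteValue_eq_zero_of_bridge [Finite V] (t : R) (he : e ∈ A) (hw : w ∈ S) {x : V}
    (hx : x ∉ S) (hj : G.Joins e w x) {X : Set V} (hXS : X ⊆ S) (hwX : w ∈ X)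
    (hX : ∀ f ∈ A, ∀ v ∈ X, ∀ y ∉ X, G.Joins f v y → f = e ∧ v = w) :
    G.tutteValue t S A = 0 := by
  rw [tutteValue_eq_add t he hw hx hj, tutteValue, tutteValue, ← Finset.sum_add_distrib]
  refine Finset.sum_eq_zero fun B hB => ?_
  rw [Finset.mem_powerset] at hB
  have hne : Nonempty V := ⟨w⟩
  -- Positivity is needed because the truncated exponent `components - 1` must really change by one.
  have hpos : 0 < G.components (S.erase w) B := components_pos
  rw [components_bridge hx hXS hwX fun f hf v hv y hy hj' =>
    Finset.ne_of_mem_erase (hB hf) (hX f (Finset.mem_of_mem_erase (hB hf)) v hv y hy hj').1,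
    ← Finset.card_erase_add_one hw]
  obtain ⟨n, hn⟩ := Nat.exists_eq_succ_of_ne_zero hpos.ne'
  rw [hn]
  have h1 : n.succ + 1 - 1 = n + 1 := by omega
  have h2 : n.succ - 1 = n := by omega
  have h3 : n.succ + 1 + B.card - ((S.erase w).card + 1 + 1) =
    n.succ + B.card - ((S.erase w).card + 1) := by omega
  rw [h1, h2, h3]
  ring

theorem tutteValue_empty [Nonempty V] (t : R) : G.tutteValue t ∅ A = t ^ A.card := by
  have := Finset.sum_pow_mul_eq_add_pow (t - 1) 1 A
  rw [sub_add_cancel] at this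
  rw [← this, tutteValue]
  refine Finset.sum_congr rfl fun B _ => ?_
  have : G.components ∅ B = 1 := components_empty
  rw [this]
  simp

theorem finsum_subpark_empty [Fintype V] [Nonempty V] :
    ∑ᶠ c ∈ G.subpark pos ∅ A, (HahnSeries.single (∑ v, c v) 1 : LaurentSeries ℤ) =
      HahnSeries.single ((A.card : ℤ) - (∅ : Finset V).card) 1 *
        G.tutteValue (HahnSeries.single (-1 : ℤ) 1 : LaurentSeries ℤ) ∅ A := by
  rw [subpark_empty, finsum_mem_singleton, tutteValue_empty, HahnSeries.single_pow,
    HahnSeries.single_mul_single]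
  simp

/-- The generating function of the degrees of the subparking functions. -/
theorem IsOuterOrder.finsum_subpark [Fintype V] [Nonempty V] (h : G.IsOuterOrder T pos S A) :
    ∑ᶠ c ∈ G.subpark pos S A, (HahnSeries.single (∑ v, c v) 1 : LaurentSeries ℤ) =
      HahnSeries.single ((A.card : ℤ) - S.card) 1 *
        G.tutteValue (HahnSeries.single (-1 : ℤ) 1 : LaurentSeries ℤ) S A := by
  induction hn : A.card generalizing S A with
  | zero =>
    obtain rfl := h.eq_empty_of_card_eq_zero hn
    rw [← hn]; exact finsum_subpark_empty
  | succ n ih =>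
    by_cases hex : ∃ e w, G.IsRootEdge T S A e w
    · obtain ⟨e, w, he⟩ := hex
      obtain ⟨x, hx, hj⟩ := he.tail
      have hcard : (A.erase e).card = n := by rw [Finset.card_erase_of_mem he.mem, hn]; rfl
      rw [he.subpark_eq h, finsum_mem_union (he.subpark_disjoint h)
        (subpark_finite.image _) subpark_finite, finsum_mem_image
        (fun _ _ _ _ h => add_right_cancel h), ih (h.contract he) hcard,
        tutteValue_eq_add _ he.mem he.head hx hj, mul_add]
      congr 1
      -- Deletion lowers `|A| - |S|` by one, which the shift at `w` makes up for; contraction leaves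
      -- the difference unchanged.
      · have h1 : ∀ c : V → ℤ, (HahnSeries.single (∑ v, (c + Pi.single w (1 : ℤ) : V → ℤ) v) 1 :
            LaurentSeries ℤ) = HahnSeries.single 1 1 * HahnSeries.single (∑ v, c v) 1 := by
          intro c
          rw [HahnSeries.single_mul_single, one_mul]
          congr 1
          simp [Finset.sum_add_distrib, add_comm]
        simp_rw [h1]
        rw [← mul_finsum_mem' _ _ subpark_finite, ih (h.erase_edge he) hcard, ← mul_assoc,
          HahnSeries.single_mul_single, one_mul]
        congr 3
        push_cast
        ring
      · congr 3
        rw [← Finset.card_erase_add_one he.head]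
        push_cast
        ring
    · push Not at hex
      rcases S.eq_empty_or_nonempty with rfl | hS
      · rw [← hn]; exact finsum_subpark_empty
      · obtain ⟨e, he, w, hw, x, hx, hj, X, hXS, hwX, hmin, hX⟩ := h.exists_bridge hS hex
        rw [subpark_eq_empty_of_bridge hXS hwX hmin hX,
          tutteValue_eq_zero_of_bridge _ he hw hx hj hXS hwX hX]
        simp

end Multigraph

/-! ### Hilbert series of quotients by monomial ideals -/

section MonomialIdeal

open MvPolynomial

variable {σ k : Type*} [Field k]

/-- The standard monomials of degree `i` form a basis of the homogeneous part of degree `i` of the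
quotient by a monomial ideal. -/
theorem finrank_map_homogeneousSubmodule_span_monomial (s : Set (σ →₀ ℕ)) (i : ℕ) :
    Module.finrank k ((homogeneousSubmodule σ k i).map (Ideal.Quotient.mkₐ k
      (Ideal.span ((fun m => monomial m (1 : k)) '' s))).toLinearMap) =
      {c : σ →₀ ℕ | c.degree = i ∧ ∀ m ∈ s, ¬ m ≤ c}.ncard := by
  set I := Ideal.span ((fun m => monomial m (1 : k)) '' s)
  set N := {c : σ →₀ ℕ | c.degree = i ∧ ∀ m ∈ s, ¬ m ≤ c}
  set f := (Ideal.Quotient.mkₐ k I).toLinearMap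
  -- Monomials divisible by a generator vanish in the quotient, so the remaining ones span.
  have hmap : (homogeneousSubmodule σ k i).map f = (restrictSupport k N).map f := by
    apply le_antisymm
    · rw [homogeneousSubmodule_eq_finsupp_supported]
      change (restrictSupport k {d : σ →₀ ℕ | d.degree = i}).map f ≤ _
      rw [restrictSupport_eq_span, Submodule.map_span_le]
      rintro _ ⟨d, hd, rfl⟩
      by_cases hdN : d ∈ N
      · exact Submodule.mem_map_of_mem ((monomial_mem_restrictSupport k).2 (Or.inl hdN))
      · have : ∃ m ∈ s, m ≤ d := by
          by_contra! hcon
          exact hdN ⟨hd, hcon⟩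
        have hI : monomial d (1 : k) ∈ I := by
          rw [mem_ideal_span_monomial_image]
          intro x hx
          rw [Finset.mem_singleton.1 (support_monomial_subset hx)]
          exact this
        have h0 : f (monomial d 1) = 0 := Ideal.Quotient.eq_zero_iff_mem.2 hI
        rw [h0]
        exact zero_mem _
    · refine Submodule.map_mono fun p hp => ?_
      rw [homogeneousSubmodule_eq_finsupp_supported]
      exact restrictSupport_mono k (fun c hc => hc.1) hp
  -- They stay independent: every monomial of an element of `I` is divisible by a generator.
  have hinj : Function.Injective (f.domRestrict (restrictSupport k N)) := by
    rw [← LinearMap.ker_eq_bot, LinearMap.ker_eq_bot']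
    rintro ⟨p, hp⟩ h0
    have hI : p ∈ I := Ideal.Quotient.eq_zero_iff_mem.1 h0
    rw [mem_ideal_span_monomial_image] at hI
    rw [mem_restrictSupport_iff] at hp
    rw [Submodule.mk_eq_zero, ← support_eq_empty, Finset.eq_empty_iff_forall_notMem]
    intro c hc
    obtain ⟨m, hm, hmc⟩ := hI c hc
    exact (hp hc).2 m hm hmc
  rw [hmap, ← LinearMap.range_domRestrict, LinearMap.finrank_range_of_inj hinj,
    Module.finrank_eq_nat_card_basis (basisRestrictSupport k N), Nat.card_coe_set_eq]

/-- The Hilbert series of the quotient by a monomial ideal with finitely many standard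
monomials. -/
theorem ofPowerSeries_hilbertSeries_span_monomial (s : Set (σ →₀ ℕ))
    (hs : {c : σ →₀ ℕ | ∀ m ∈ s, ¬ m ≤ c}.Finite) :
    HahnSeries.ofPowerSeries ℤ ℤ
      (hilbertSeries (Ideal.span ((fun m => monomial m (1 : k)) '' s))) =
      ∑ᶠ c ∈ {c : σ →₀ ℕ | ∀ m ∈ s, ¬ m ≤ c}, HahnSeries.single (c.degree : ℤ) 1 := by
  have h : hilbertSeries (Ideal.span ((fun m => monomial m (1 : k)) '' s)) =
      ∑ c ∈ hs.toFinset, PowerSeries.X ^ c.degree := by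
    ext i
    rw [hilbertSeries, PowerSeries.coeff_mk, finrank_map_homogeneousSubmodule_span_monomial,
      map_sum]
    simp_rw [PowerSeries.coeff_X_pow]
    rw [Finset.sum_boole, Set.ncard_eq_toFinset_card _ (hs.subset fun c hc => hc.2)]
    congr 2
    ext c
    simp [and_comm, eq_comm]
  rw [h, map_sum, finsum_mem_eq_finite_toFinset_sum _ hs]
  exact Finset.sum_congr rfl fun c _ => HahnSeries.ofPowerSeries_X_pow _

end MonomialIdeal

namespace Multigraph

variable {V E : Type*}

theorem subparkingIdeal_eq_span (k : Type*) [Field k] (G : Multigraph V E) (q : V)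
    (lt : E → E → Prop) : G.subparkingIdeal k q lt =
      Ideal.span ((fun m => MvPolynomial.monomial m (1 : k)) ''
        {m | ∃ U : Finset {v : V // v ≠ q}, U.Nonempty ∧ m = ∑ u ∈ U, Finsupp.single u
          (G.cutDeg lt (Subtype.val '' (U : Set {v : V // v ≠ q})) u.1)}) := by
  rw [subparkingIdeal]
  congr 1
  ext f
  simp only [Set.mem_ofPred_eq, Set.mem_image, MvPolynomial.X_pow_eq_monomial,
    ← MvPolynomial.monomial_sum_one]
  constructor
  · rintro ⟨U, hU, rfl⟩
    exact ⟨_, ⟨U, hU, rfl⟩, rfl⟩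
  · rintro ⟨_, ⟨U, hU, rfl⟩, rfl⟩
    exact ⟨U, hU, rfl⟩

theorem sum_single_le_iff {σ : Type*} (U : Finset σ) (d : σ → ℕ) (c : σ →₀ ℕ) :
    ∑ u ∈ U, Finsupp.single u (d u) ≤ c ↔ ∀ u ∈ U, d u ≤ c u := by
  have : ∀ v, (∑ u ∈ U, Finsupp.single u (d u)) v = if v ∈ U then d v else 0 := fun v => by
    simp [Finsupp.finsetSum_apply, Finsupp.single_apply]
  refine ⟨fun h u hu => ?_, fun h v => ?_⟩
  · simpa [this, hu] using h u
  · rw [this]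
    split_ifs with hv
    · exact h v hv
    · exact Nat.zero_le _

end Multigraph

/-! ### Planarity through homology modulo two -/

namespace Multigraph

variable {V E : Type*} {G : Multigraph V E}

@[simp] theorem Dart.rev_rev (d : Dart E) : Dart.rev (Dart.rev d) = d := by
  obtain ⟨e, b⟩ := d
  cases b <;> rfl

@[simp] theorem Dart.rev_fst (d : Dart E) : (Dart.rev d).1 = d.1 := rfl

@[simp] theorem src_rev (d : Dart E) : G.src (Dart.rev d) = G.tgt d := by
  obtain ⟨e, b⟩ := d
  cases b <;> rfl

@[simp] theorem tgt_rev (d : Dart E) : G.tgt (Dart.rev d) = G.src d := by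
  obtain ⟨e, b⟩ := d
  cases b <;> rfl

theorem Dart.eq_or_eq_rev {d d' : Dart E} (h : d.1 = d'.1) : d = d' ∨ d = Dart.rev d' := by
  obtain ⟨e, b⟩ := d
  obtain ⟨f, c⟩ := d'
  obtain rfl : e = f := h
  cases b <;> cases c <;> simp [Dart.rev]

theorem Dart.rev_ne (d : Dart E) : Dart.rev d ≠ d := by
  obtain ⟨e, b⟩ := d
  cases b <;> simp [Dart.rev]

namespace OuterplanarDrawing

variable (P : G.OuterplanarDrawing)

theorem faceNext_apply (d : Dart E) : P.faceNext d = P.rot (Dart.rev d) := rfl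

theorem src_rot (d : Dart E) : G.src (P.rot d) = G.src d :=
  (P.rot_sameCycle _ _).1 (Equiv.Perm.SameCycle.symm ⟨1, by simp⟩)

theorem src_faceNext (d : Dart E) : G.src (P.faceNext d) = G.tgt d := by
  rw [faceNext_apply, src_rot, src_rev]

/-- The faces of a drawing of a graph with at least one edge. -/
abbrev Face := Quotient (Equiv.Perm.SameCycle.setoid (P.rot * Dart.rev))

/-- The face on the right-hand side. -/
def face (d : Dart E) : P.Face := Quotient.mk _ d

theorem face_faceNext (d : Dart E) : P.face (P.faceNext d) = P.face d :=
  Quotient.sound (Equiv.Perm.SameCycle.symm ⟨1, by simp [faceNext]⟩)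

end OuterplanarDrawing

theorem add_self_eq_zero_of_zmod_two {α : Type*} (f : α → ZMod 2) : f + f = 0 :=
  funext fun _ => CharTwo.add_self_eq_zero _

/-- The boundary of a chain of edges modulo two. -/
noncomputable def edgeBoundary [Fintype E] (G : Multigraph V E) :
    (E → ZMod 2) →ₗ[ZMod 2] (V → ZMod 2) where
  toFun Z v := ∑ d : Dart E, if G.src d = v then Z d.1 else 0
  map_add' Z Z' := by
    ext v
    simp only [Pi.add_apply, ← Finset.sum_add_distrib]
    exact Finset.sum_congr rfl fun d _ => by split_ifs <;> simp
  map_smul' r Z := by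
    ext v
    simp only [Pi.smul_apply, smul_eq_mul, RingHom.id_apply, Finset.mul_sum, mul_ite, mul_zero]

/-- The boundary of a chain of faces modulo two. -/
def OuterplanarDrawing.faceBoundary (P : G.OuterplanarDrawing) :
    (P.Face → ZMod 2) →ₗ[ZMod 2] (E → ZMod 2) where
  toFun g e := g (P.face (e, true)) + g (P.face (e, false))
  map_add' g g' := by
    ext e
    simp only [Pi.add_apply]
    ring
  map_smul' r g := by
    ext e
    simp only [Pi.smul_apply, smul_eq_mul, RingHom.id_apply]
    ring

theorem OuterplanarDrawing.faceBoundary_apply (P : G.OuterplanarDrawing) (g : P.Face → ZMod 2)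
    (d : Dart E) : P.faceBoundary g d.1 = g (P.face d) + g (P.face (Dart.rev d)) := by
  obtain ⟨e, b⟩ := d
  cases b
  · exact add_comm _ _
  · rfl

theorem edgeBoundary_single [Fintype E] (d : Dart E) :
    G.edgeBoundary (Pi.single d.1 1) = Pi.single (G.src d) 1 + Pi.single (G.tgt d) 1 := by
  ext v
  change ∑ d' : Dart E, (if G.src d' = v then (Pi.single d.1 1 : E → ZMod 2) d'.1 else 0) = _
  rw [Finset.sum_eq_add d (Dart.rev d) (Dart.rev_ne d).symm]
  · simp [Pi.single_apply, eq_comm]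
  · rintro d' - ⟨h1, h2⟩
    have : d'.1 ≠ d.1 := fun h => (Dart.eq_or_eq_rev h).elim h1 h2
    simp [this]
  · simp
  · simp

/-- The face to the right of the reversed dart is the face of the next dart around the tail. Each
face at `v` is thus counted twice in the sum over the darts at `v`. -/
theorem OuterplanarDrawing.edgeBoundary_faceBoundary [Fintype E] (P : G.OuterplanarDrawing)
    (g : P.Face → ZMod 2) : G.edgeBoundary (P.faceBoundary g) = 0 := by
  ext v
  change ∑ d : Dart E, (if G.src d = v then P.faceBoundary g d.1 else 0) = 0
  have h1 : ∀ d : Dart E, (if G.src d = v then P.faceBoundary g d.1 else 0) =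
      (if G.src d = v then g (P.face d) else 0) +
      (if G.src (P.rot d) = v then g (P.face (P.rot d)) else 0) := by
    intro d
    have h2 : P.face (P.rot d) = P.face (Dart.rev d) := by
      rw [← P.face_faceNext (Dart.rev d), P.faceNext_apply, Dart.rev_rev]
    rw [P.src_rot, h2, P.faceBoundary_apply]
    split_ifs <;> simp
  rw [Finset.sum_congr rfl fun d _ => h1 d, Finset.sum_add_distrib,
    Equiv.sum_comp P.rot (fun d => if G.src d = v then g (P.face d) else 0)]
  exact CharTwo.add_self_eq_zero _

/-- By connectedness the range contains the sum of the unit vectors at `q` and `v` for every `v`;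
one more vector, the unit vector at `q`, generates everything. -/
theorem le_finrank_range_edgeBoundary [Fintype V] [Fintype E] (hG : G.Connected) :
    Fintype.card V ≤ Module.finrank (ZMod 2) (LinearMap.range G.edgeBoundary) + 1 := by
  rcases isEmpty_or_nonempty V with hV | ⟨⟨q⟩⟩
  · simp
  set W := LinearMap.range G.edgeBoundary
  set L := Submodule.span (ZMod 2) {(Pi.single q 1 : V → ZMod 2)}
  have hmem : ∀ v, (Pi.single q 1 + Pi.single v 1 : V → ZMod 2) ∈ W := by
    intro v
    induction hG q v with
    | refl => rw [add_self_eq_zero_of_zmod_two]; exact zero_mem _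
    | tail _ h ih =>
      rename_i u v _
      obtain ⟨e, he⟩ := h
      obtain ⟨b, hb1, hb2⟩ := he.exists_dart
      have := W.add_mem ih ⟨Pi.single e 1, edgeBoundary_single (e, b)⟩
      rw [hb1, hb2] at this
      have h2 : (Pi.single u 1 + Pi.single u 1 : V → ZMod 2) = 0 :=
        add_self_eq_zero_of_zmod_two _
      rwa [add_assoc, ← add_assoc (Pi.single u 1), h2, zero_add] at this
  have htop : W ⊔ L = ⊤ := by
    rw [eq_top_iff, ← (Pi.basisFun (ZMod 2) V).span_eq, Submodule.span_le]
    rintro _ ⟨v, rfl⟩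
    rw [Pi.basisFun_apply]
    have h2 : (Pi.single q 1 + Pi.single q 1 : V → ZMod 2) = 0 :=
        add_self_eq_zero_of_zmod_two _
    have h3 : (Pi.single v 1 : V → ZMod 2) = (Pi.single q 1 + Pi.single v 1) + Pi.single q 1 := by
      rw [add_right_comm, h2, zero_add]
    rw [h3]
    exact Submodule.add_mem_sup (hmem v) (Submodule.mem_span_singleton_self _)
  have h1 := Submodule.finrank_add_le_finrank_add_finrank W L
  rw [htop, finrank_top, Module.finrank_fintype_fun_eq_card] at h1
  have h2 : Module.finrank (ZMod 2) L ≤ 1 := (finrank_span_le_card _).trans (by simp)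
  omega

/-- A chain in the kernel takes equal values on both sides of each edge, hence is constant around
each vertex and, by connectedness, everywhere. -/
theorem OuterplanarDrawing.finrank_ker_faceBoundary_le [Fintype E] (P : G.OuterplanarDrawing)
    (hG : G.Connected) : Module.finrank (ZMod 2) (LinearMap.ker P.faceBoundary) ≤ 1 := by
  have hle : LinearMap.ker P.faceBoundary ≤
      Submodule.span (ZMod 2) {(fun _ => 1 : P.Face → ZMod 2)} := by
    intro g hg
    have hrev : ∀ d, g (P.face (Dart.rev d)) = g (P.face d) := by
      intro d
      have := congrFun (LinearMap.mem_ker.1 hg) d.1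
      rw [P.faceBoundary_apply] at this
      exact (CharTwo.add_eq_zero.1 this).symm
    have hrot : ∀ d, g (P.face (P.rot d)) = g (P.face d) := by
      intro d
      rw [← hrev d, ← P.face_faceNext (Dart.rev d), P.faceNext_apply, Dart.rev_rev]
    have hsrc : ∀ d d', G.src d = G.src d' → g (P.face d) = g (P.face d') := by
      intro d d' h
      obtain ⟨n, rfl⟩ := ((P.rot_sameCycle d d').2 h).exists_nat_pow_eq
      induction n with
      | zero => rfl
      | succ n ih =>
        rw [pow_succ', Equiv.Perm.mul_apply, hrot]
        refine ih ?_
        rwa [pow_succ', Equiv.Perm.mul_apply, P.src_rot] at h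
    have hconst : ∀ u v, ∀ d d', G.src d = u → G.src d' = v → g (P.face d) = g (P.face d') := by
      intro u v d d' hd hd'
      induction hG u v generalizing d' with
      | refl => exact hsrc d d' (hd.trans hd'.symm)
      | tail _ h ih =>
        obtain ⟨e, he⟩ := h
        obtain ⟨b, hb1, hb2⟩ := he.exists_dart
        rw [ih (e, b) hb1, ← hrev]
        exact hsrc _ _ (by rw [src_rev, hb2, hd'])
    rw [Submodule.mem_span_singleton]
    rcases isEmpty_or_nonempty (Dart E) with hE | ⟨⟨d⟩⟩
    · refine ⟨0, funext fun x => ?_⟩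
      induction x using Quotient.inductionOn with
      | h d => exact hE.elim d
    · refine ⟨g (P.face d), funext fun x => ?_⟩
      induction x using Quotient.inductionOn with
      | h d' =>
        rw [Pi.smul_apply, smul_eq_mul, mul_one]
        exact hconst _ _ d d' rfl rfl
  exact (Submodule.finrank_mono hle).trans ((finrank_span_le_card _).trans (by simp))

/-- By Euler's formula, every cycle modulo two bounds. -/
theorem OuterplanarDrawing.exists_faceBoundary_eq [Fintype V] [Fintype E] [Nonempty E]
    (P : G.OuterplanarDrawing)
    (hG : G.Connected) {Z : E → ZMod 2} (hZ : G.edgeBoundary Z = 0) :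
    ∃ g, P.faceBoundary g = Z := by
  -- The boundaries have dimension at least `F - 1` and the cycles at most `E - V + 1`, for `F`
  -- faces, `E` edges and `V` vertices. Euler's formula makes these two numbers equal.
  have hle : LinearMap.range P.faceBoundary ≤ LinearMap.ker G.edgeBoundary := by
    rintro _ ⟨g, rfl⟩
    exact P.edgeBoundary_faceBoundary g
  have h1 := LinearMap.finrank_range_add_finrank_ker P.faceBoundary
  have h2 := LinearMap.finrank_range_add_finrank_ker G.edgeBoundary
  have h3 := P.finrank_ker_faceBoundary_le hG
  have h4 := le_finrank_range_edgeBoundary hG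
  have h5 := P.euler
  rw [Module.finrank_fintype_fun_eq_card] at h1 h2
  rw [Nat.card_eq_fintype_card, Nat.card_eq_fintype_card, Nat.card_eq_fintype_card] at h5
  have h6 : 0 < Fintype.card P.Face :=
    Fintype.card_pos_iff.2 ⟨P.face (Classical.arbitrary E, true)⟩
  rw [max_eq_right h6] at h5
  have heq : LinearMap.range P.faceBoundary = LinearMap.ker G.edgeBoundary := by
    apply Submodule.eq_of_le_of_finrank_le hle
    have : Fintype.card P.Face = Fintype.card (Quotient (Equiv.Perm.SameCycle.setoid
      (P.rot * Dart.rev))) := rfl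
    omega
  have : Z ∈ LinearMap.range P.faceBoundary := heq ▸ hZ
  exact this

/-- The oriented edges of the tour of a face. -/
def OuterplanarDrawing.tour (P : G.OuterplanarDrawing) (d : Dart E) (i : ℕ) : Dart E :=
  P.faceNext^[i] d

theorem OuterplanarDrawing.tour_succ (P : G.OuterplanarDrawing) (d : Dart E) (i : ℕ) :
    P.tour d (i + 1) = P.faceNext (P.tour d i) := Function.iterate_succ_apply' _ _ _

theorem OuterplanarDrawing.face_tour (P : G.OuterplanarDrawing) (d : Dart E) (i : ℕ) :
    P.face (P.tour d i) = P.face d := by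
  induction i with
  | zero => rfl
  | succ i ih => rw [P.tour_succ, P.face_faceNext, ih]

theorem OuterplanarDrawing.src_tour_succ (P : G.OuterplanarDrawing) (d : Dart E) (i : ℕ) :
    G.src (P.tour d (i + 1)) = G.tgt (P.tour d i) := by rw [P.tour_succ, P.src_faceNext]

theorem OuterplanarDrawing.edgeBoundary_tour [Fintype E] (P : G.OuterplanarDrawing)
    (d : Dart E) {i j : ℕ}
    (hij : i ≤ j) : G.edgeBoundary (∑ k ∈ Finset.Ico i j, Pi.single (P.tour d k).1 1) =
      Pi.single (G.src (P.tour d i)) 1 + Pi.single (G.src (P.tour d j)) 1 := by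
  induction j, hij using Nat.le_induction with
  | base => simp [add_self_eq_zero_of_zmod_two]
  | succ j hij ih =>
    rw [Finset.sum_Ico_succ_top hij, map_add, ih, edgeBoundary_single, P.src_tour_succ]
    have : (Pi.single (G.src (P.tour d j)) 1 + Pi.single (G.src (P.tour d j)) 1 : V → ZMod 2) = 0 :=
      add_self_eq_zero_of_zmod_two _
    rw [add_assoc, ← add_assoc (Pi.single (G.src (P.tour d j)) 1), this, zero_add]

/-- An edge `e` that joins two vertices `a`, `c` on the tour of a face separates the part of the
tour between them from the rest. -/
theorem OuterplanarDrawing.separation [Fintype V] [Fintype E] (P : G.OuterplanarDrawing)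
    (hG : G.Connected)
    (d : Dart E) {i j : ℕ} (hij : i < j) (hj : j < Function.minimalPeriod P.faceNext d) {e : E}
    {a c : V} (he : G.Joins e a c) (ha : G.src (P.tour d i) = a) (hc : G.src (P.tour d j) = c)
    {k l : ℕ} (hk : k < Function.minimalPeriod P.faceNext d)
    (hl : l < Function.minimalPeriod P.faceNext d) {u v : V} (hku : G.src (P.tour d k) = u)
    (hlv : G.src (P.tour d l) = v) (hua : u ≠ a) (huc : u ≠ c) (hva : v ≠ a) (hvc : v ≠ c)
    (huv : u = v ∨ ∃ f, G.Joins f u v) : (i ≤ k ∧ k < j) ↔ (i ≤ l ∧ l < j) := by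
  have hE : Nonempty E := ⟨e⟩
  -- The stretch of the tour from `a` to `c`, closed up by `e`, is a cycle and hence bounds a set
  -- `g` of faces.
  set Z : E → ZMod 2 := (∑ k ∈ Finset.Ico i j, Pi.single (P.tour d k).1 1) + Pi.single e 1
  have hZ : G.edgeBoundary Z = 0 := by
    obtain ⟨b, hb1, hb2⟩ := he.exists_dart
    rw [map_add, P.edgeBoundary_tour d hij.le, edgeBoundary_single (e, b), hb1, hb2, ha, hc]
    exact add_self_eq_zero_of_zmod_two _
  obtain ⟨g, hg⟩ := P.exists_faceBoundary_eq hG hZ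
  set z : Dart E → ZMod 2 := fun x => ∑ k ∈ Finset.Ico i j, if P.tour d k = x then 1 else 0 with hz
  have hZz : ∀ x : Dart E, x.1 ≠ e → Z x.1 = z x + z (Dart.rev x) := by
    intro x hx
    simp only [Z, hz, Pi.add_apply, Finset.sum_apply, Pi.single_apply, if_neg hx, add_zero,
      ← Finset.sum_add_distrib]
    refine Finset.sum_congr rfl fun k _ => ?_
    by_cases h1 : x.1 = (P.tour d k).1
    · rw [if_pos h1]
      rcases Dart.eq_or_eq_rev h1.symm with h2 | h2
      · simp [h2, (Dart.rev_ne x).symm]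
      · simp [h2, Dart.rev_ne x]
    · have h2 : P.tour d k ≠ x := fun h => h1 (by rw [h])
      have h3 : P.tour d k ≠ Dart.rev x := fun h => h1 (by rw [h, Dart.rev_fst])
      simp [h1, h2, h3]
  have hgZ : ∀ x : Dart E, g (P.face x) + g (P.face (Dart.rev x)) = Z x.1 := fun x => by
    rw [← hg, P.faceBoundary_apply]
  have hne : ∀ x : Dart E, G.src x ≠ a → G.src x ≠ c → x.1 ≠ e := by
    rintro x h1 h2 rfl
    rcases (G.joins_src_tgt x).ends_eq he with h | h
    · exact h1 h.1
    · exact h2 h.1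
  -- The tour goes from `rev x` directly to `rot x`, so the two counts differ only at the ends of
  -- the stretch, whose tails are `a` and `c`.
  have hzrot : ∀ x : Dart E, G.src x ≠ a → G.src x ≠ c → z (P.rot x) = z (Dart.rev x) := by
    intro x h1 h2
    have h3 : ∀ k, P.tour d k = Dart.rev x ↔ P.tour d (k + 1) = P.rot x := by
      intro k
      rw [P.tour_succ]
      have : P.rot x = P.faceNext (Dart.rev x) := by rw [P.faceNext_apply, Dart.rev_rev]
      rw [this, P.faceNext.injective.eq_iff]
    have hi : P.tour d i ≠ P.rot x := fun h => h1 (by rw [← P.src_rot, ← h, ha])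
    have hj : P.tour d j ≠ P.rot x := fun h => h2 (by rw [← P.src_rot, ← h, hc])
    simp only [hz, h3]
    rw [Finset.sum_Ico_add' (fun k => if P.tour d k = P.rot x then (1 : ZMod 2) else 0) i j 1]
    have e1 := Finset.sum_Ico_succ_top hij.le
      (fun k => if P.tour d k = P.rot x then (1 : ZMod 2) else 0)
    have e2 := Finset.sum_eq_sum_Ico_succ_bot (Nat.lt_succ_of_lt hij)
      (fun k => if P.tour d k = P.rot x then (1 : ZMod 2) else 0)
    rw [e1, if_neg hj, if_neg hi, add_zero, zero_add] at e2
    exact e2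
  -- The function `h` tells on which side of `e` a dart lies: `g` and `z` change together across
  -- every edge except `e`. So `h` is constant around every vertex other than `a` and `c`, and along
  -- edges between such vertices.
  set h : Dart E → ZMod 2 := fun x => g (P.face x) + z x with hh
  have hrot : ∀ x, G.src x ≠ a → G.src x ≠ c → h (P.rot x) = h x := by
    intro x h1 h2
    have h3 : P.face (P.rot x) = P.face (Dart.rev x) := by
      rw [← P.face_faceNext (Dart.rev x), P.faceNext_apply, Dart.rev_rev]
    have h4 := (hgZ x).trans (hZz x (hne x h1 h2))
    simp only [hh, hzrot x h1 h2, h3]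
    rw [← CharTwo.add_eq_zero] at h4 ⊢
    rw [← h4]
    ring
  have hsrc : ∀ x y, G.src x = G.src y → G.src x ≠ a → G.src x ≠ c → h x = h y := by
    intro x y hxy h1 h2
    obtain ⟨n, rfl⟩ := ((P.rot_sameCycle x y).2 hxy).exists_nat_pow_eq
    induction n with
    | zero => rfl
    | succ n ih =>
      have h3 : G.src x = G.src ((P.rot ^ n) x) := by
        rwa [pow_succ', Equiv.Perm.mul_apply, P.src_rot] at hxy
      rw [pow_succ', Equiv.Perm.mul_apply, hrot _ (h3 ▸ h1) (h3 ▸ h2)]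
      exact ih h3
  -- All darts of the tour have the same face, and they are distinct within one period, so on the
  -- tour `h` records membership in the stretch.
  have houter : ∀ k, k < Function.minimalPeriod P.faceNext d →
      h (P.tour d k) = g (P.face d) + if i ≤ k ∧ k < j then 1 else 0 := by
    intro k hk
    simp only [hh, P.face_tour, hz]
    congr 1
    have : ∀ k' ∈ Finset.Ico i j, (if P.tour d k' = P.tour d k then (1 : ZMod 2) else 0) =
        if k' = k then 1 else 0 := by
      intro k' hk'
      have hk'j := (Finset.mem_Ico.1 hk').2
      congr 1
      exact propext ⟨fun h => Function.iterate_injOn_Iio_minimalPeriod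
        (Set.mem_Iio.2 (hk'j.trans hj)) (Set.mem_Iio.2 hk) h, fun h => by rw [h]⟩
    rw [Finset.sum_congr rfl this]
    simp
  have hkl : h (P.tour d k) = h (P.tour d l) := by
    rcases huv with rfl | ⟨f, hf⟩
    · exact hsrc _ _ (hku.trans hlv.symm) (hku ▸ hua) (hku ▸ huc)
    · obtain ⟨b, hb1, hb2⟩ := hf.exists_dart
      have h1 : h (P.tour d k) = h (f, b) := hsrc _ _ (hku.trans hb1.symm) (hku ▸ hua) (hku ▸ huc)
      have h2 : h (P.tour d l) = h (Dart.rev (f, b)) :=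
        hsrc _ _ (by rw [hlv, src_rev, hb2]) (hlv ▸ hva) (hlv ▸ hvc)
      rw [h1, h2, hh]
      have h4 := (hgZ (f, b)).trans (hZz (f, b) (hne (f, b) (hb1 ▸ hua) (hb1 ▸ huc)))
      rw [← CharTwo.add_eq_zero] at h4 ⊢
      rw [← h4]
      ring
  rw [houter k hk, houter l hl, add_right_inj] at hkl
  by_cases h1 : i ≤ k ∧ k < j <;> by_cases h2 : i ≤ l ∧ l < j <;> simp [h1, h2] at hkl ⊢

end Multigraph

/-! ### The order of first visits on a boundary walk -/

namespace Multigraph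

variable {V E : Type*} {G : Multigraph V E} {q : V} {T : List (Dart E)} {pos : V → ℕ}

/-- `T` lists the edges of a `q`-rooted spanning tree in the order of the positions of their heads,
the graph is drawn without crossings below a line on which the vertices are placed according to
`pos`, and every edge of `T` joins its head to the last neighbour among those before it. -/
structure IsBoundaryOrder (G : Multigraph V E) (q : V) (T : List (Dart E)) (pos : V → ℕ) :
    Prop where
  inj : Function.Injective pos
  root : pos q = 0
  sorted : T.Pairwise fun d d' => pos (G.tgt d) < pos (G.tgt d')
  mem_iff : ∀ v, v ∈ T.map G.tgt ↔ v ≠ q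
  src_lt : ∀ d ∈ T, pos (G.src d) < pos (G.tgt d)
  noncrossing : ∀ e f a b c d, G.Joins e a c → G.Joins f b d →
    pos a < pos b → pos b < pos c → ¬ pos c < pos d
  last : ∀ d ∈ T, ∀ e x, G.Joins e (G.tgt d) x → pos x < pos (G.tgt d) → pos x ≤ pos (G.src d)

/-- Here `s` is the sequence of visited vertices and `pos` the time of the first visit, so the step
at time `i` discovers a vertex exactly when the first visit to its head happens at time `i + 1`. -/
theorem firstVisits_eq_filter {s : ℕ → V} {t : ℕ → Dart E} (ht : ∀ i, G.tgt (t i) = s (i + 1))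
    (hs : ∀ i, s (pos (s i)) = s i) (hle : ∀ i, pos (s i) ≤ i) (n k : ℕ) (seen : List V)
    (hseen : ∀ v, v ∈ seen ↔ ∃ i ≤ k, s i = v) :
    G.firstVisits seen ((List.range' k n).map t) =
      ((List.range' k n).filter fun i => pos (s (i + 1)) = i + 1).map t := by
  induction n generalizing k seen with
  | zero => rfl
  | succ n ih =>
    rw [List.range'_succ, List.map_cons, firstVisits, ht, List.filter_cons]
    split_ifs with h1 h2 h2
    · obtain ⟨i, hi, hsi⟩ := (hseen _).1 h1
      have := hle i
      rw [hsi, of_decide_eq_true h2] at this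
      omega
    · refine ih _ _ fun v => (hseen v).trans ⟨?_, ?_⟩
      · rintro ⟨i, hi, rfl⟩
        exact ⟨i, hi.trans (Nat.le_succ k), rfl⟩
      · rintro ⟨i, hi, rfl⟩
        rcases hi.lt_or_eq with hi | rfl
        · exact ⟨i, Nat.le_of_lt_succ hi, rfl⟩
        · exact (hseen _).1 h1
    · rw [List.map_cons]
      congr 1
      refine ih _ _ fun v => ?_
      rw [List.mem_cons, hseen]
      constructor
      · rintro (rfl | ⟨i, hi, rfl⟩)
        · exact ⟨k + 1, le_rfl, rfl⟩
        · exact ⟨i, hi.trans (Nat.le_succ k), rfl⟩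
      · rintro ⟨i, hi, rfl⟩
        rcases hi.lt_or_eq with hi | rfl
        · exact Or.inr ⟨i, Nat.le_of_lt_succ hi, rfl⟩
        · exact Or.inl rfl
    · refine absurd ((hseen _).2 ⟨pos (s (k + 1)), ?_, hs _⟩) h1
      have := hle (k + 1)
      simp only [decide_eq_true_eq] at h2
      omega

theorem Connected.subsingleton_of_isEmpty [IsEmpty E] (hG : G.Connected) : Subsingleton V := by
  refine ⟨fun u v => ?_⟩
  induction hG u v with
  | refl => rfl
  | tail _ h _ => exact isEmptyElim h.choose

theorem OuterplanarDrawing.minimalPeriod_pos [Finite E] (P : G.OuterplanarDrawing) (d : Dart E) :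
    0 < Function.minimalPeriod P.faceNext d :=
  Function.minimalPeriod_pos_of_mem_periodicPts
    (Function.Injective.mem_periodicPts P.faceNext.injective d)

theorem OuterplanarDrawing.exists_tour_src_eq [Finite E] (P : G.OuterplanarDrawing) {d : Dart E}
    (hd : d ∈ P.outer) (v : V) :
    ∃ i < Function.minimalPeriod P.faceNext d, G.src (P.tour d i) = v := by
  obtain ⟨d', hd', rfl⟩ := P.vertex_outer ⟨d.1⟩ v
  obtain ⟨n, rfl⟩ := ((P.outer_face d hd d').1 hd').exists_nat_pow_eq
  refine ⟨n % Function.minimalPeriod P.faceNext d, Nat.mod_lt _ (P.minimalPeriod_pos d), ?_⟩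
  rw [OuterplanarDrawing.tour, Function.iterate_mod_minimalPeriod_eq, Equiv.Perm.iterate_eq_pow]
  rfl

theorem IsBoundaryTree.exists_isBoundaryOrder [Fintype V] [Fintype E] (hG : G.Connected)
    (hT : G.IsBoundaryTree q T) : ∃ pos, G.IsBoundaryOrder q T pos := by
  obtain ⟨P, w, ⟨hE, rfl⟩ | ⟨d, hd, hdq, rfl⟩, rfl⟩ := hT
  · have := hG.subsingleton_of_isEmpty
    exact ⟨fun _ => 0, fun _ _ _ => Subsingleton.elim _ _, rfl, by simp [firstVisits],
      fun v => by simpa [firstVisits] using Subsingleton.elim v q, by simp [firstVisits],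
      fun e => isEmptyElim e, by simp [firstVisits]⟩
  set N := Function.minimalPeriod P.faceNext d
  have hex := P.exists_tour_src_eq hd
  have hex' : ∀ v, ∃ i, G.src (P.tour d i) = v := fun v => (hex v).imp fun i hi => hi.2
  set pos : V → ℕ := fun v => Nat.find (hex' v)
  have hsrc : ∀ v, G.src (P.tour d (pos v)) = v := fun v => Nat.find_spec (hex' v)
  have hle : ∀ i, pos (G.src (P.tour d i)) ≤ i := fun i => Nat.find_min' _ rfl
  have hlt : ∀ v, pos v < N := fun v => by
    obtain ⟨i, hi, rfl⟩ := hex v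
    exact (hle i).trans_lt hi
  have hinj : Function.Injective pos := fun u v h => by rw [← hsrc u, ← hsrc v, h]
  have hroot : pos q = 0 := Nat.le_zero.1 (hdq ▸ hle 0)
  have hne : ∀ {u v}, pos u < pos v → u ≠ v := fun h h' => (h' ▸ h).false
  have hT : G.firstVisits [q] ((List.range N).map fun i => (P.faceNext^[i]) d) =
      ((List.range N).filter fun i => pos (G.src (P.tour d (i + 1))) = i + 1).map (P.tour d) := by
    rw [List.range_eq_range']
    refine firstVisits_eq_filter (s := fun i => G.src (P.tour d i)) (t := P.tour d)
      (fun i => (P.src_tour_succ d i).symm) (fun i => hsrc _) hle N 0 [q] fun v => ?_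
    simp [OuterplanarDrawing.tour, hdq, eq_comm]
  have hmem : ∀ x, x ∈ G.firstVisits [q] ((List.range N).map fun i => (P.faceNext^[i]) d) ↔
      ∃ i < N, pos (G.tgt (P.tour d i)) = i + 1 ∧ P.tour d i = x := by
    intro x
    rw [hT]
    simp [P.src_tour_succ, and_assoc]
  refine ⟨pos, hinj, hroot, ?_, fun v => ?_, ?_, ?_, ?_⟩
  · rw [hT, List.pairwise_map]
    refine (List.pairwise_lt_range.filter _).imp_of_mem fun {i j} hi hj hij => ?_
    have h1 := of_decide_eq_true (List.mem_filter.1 hi).2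
    have h2 := of_decide_eq_true (List.mem_filter.1 hj).2
    rw [P.src_tour_succ] at h1 h2
    omega
  · rw [List.mem_map]
    constructor
    · rintro ⟨x, hx, rfl⟩ hq
      obtain ⟨i, -, hi, rfl⟩ := (hmem x).1 hx
      rw [hq, hroot] at hi
      omega
    · intro hv
      obtain ⟨i, hi⟩ : ∃ i, pos v = i + 1 := Nat.exists_eq_succ_of_ne_zero fun h =>
        hv (hinj (h.trans hroot.symm))
      have hv' : G.tgt (P.tour d i) = v := by rw [← P.src_tour_succ, ← hi, hsrc]
      exact ⟨_, (hmem _).2 ⟨i, by have := hlt v; omega, by rw [hv', hi], rfl⟩, hv'⟩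
  · intro x hx
    obtain ⟨i, -, hi, rfl⟩ := (hmem x).1 hx
    have := hle i
    omega
  -- Among the positions, `b` lies in the stretch cut off by the edge from `a` to `c` and `x` does
  -- not, so `b` and `x` cannot be adjacent.
  · intro e f a b c x hac hbx hab hbc hcx
    have := P.separation hG d (hab.trans hbc) (hlt c) hac (hsrc a) (hsrc c) (hlt b) (hlt x)
      (hsrc b) (hsrc x) (hne hab).symm (hne hbc) (hne (hab.trans (hbc.trans hcx))).symm
      (hne hcx).symm (Or.inr ⟨f, hbx⟩)
    omega
  -- If the tail were first visited before a neighbour `y` of the head, it would be visited both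
  -- before the stretch from `y` to the head and inside it, at time `i`. Separation applied to these
  -- two visits of one vertex excludes this.
  · intro x hx e y hj hlt'
    obtain ⟨i, hiN, hi, rfl⟩ := (hmem x).1 hx
    by_contra! hcon
    have h1 := hle i
    have h2 := hlt (G.tgt (P.tour d i))
    have := P.separation hG d hlt' h2 hj.symm (hsrc y) (hsrc _) (hlt (G.src (P.tour d i)))
      hiN (hsrc _) rfl (hne hcon) (hne (by omega)) (hne hcon) (hne (by omega)) (Or.inl rfl)
    omega

theorem IsOuterplanar.exists_isBoundaryTree (hG : G.IsOuterplanar) (q : V) :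
    ∃ T, G.IsBoundaryTree q T := by
  obtain ⟨P⟩ := hG
  rcases isEmpty_or_nonempty E with hE | hE
  · exact ⟨_, P, [], Or.inl ⟨hE, rfl⟩, rfl⟩
  · obtain ⟨d, hd, hdq⟩ := P.vertex_outer hE q
    exact ⟨_, P, _, Or.inr ⟨d, hd, hdq, rfl⟩, rfl⟩

namespace IsBoundaryOrder

theorem tgt_injOn (h : G.IsBoundaryOrder q T pos) : Set.InjOn G.tgt {d | d ∈ T} := by
  intro d hd d' hd' hdd'
  refine List.inj_on_of_nodup_map ?_ hd hd' hdd'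
  refine List.pairwise_map.2 (h.sorted.imp fun hlt heq => ?_)
  rw [heq] at hlt
  exact hlt.false

theorem exists_mem (h : G.IsBoundaryOrder q T pos) {v : V} (hv : v ≠ q) : ∃ d ∈ T, G.tgt d = v :=
  List.mem_map.1 ((h.mem_iff v).2 hv)

theorem pos_pos (h : G.IsBoundaryOrder q T pos) {v : V} (hv : v ≠ q) : 0 < pos v :=
  Nat.pos_of_ne_zero fun h0 => hv (h.inj (h0.trans h.root.symm))

theorem eq_of_fst_eq (h : G.IsBoundaryOrder q T pos) {d d' : Dart E} (hd : d ∈ T) (hd' : d' ∈ T)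
    (hdd' : d.1 = d'.1) : d = d' := by
  refine (Dart.eq_or_eq_rev hdd').resolve_right fun hrev => ?_
  have h1 := h.src_lt d hd
  have h2 := h.src_lt d' hd'
  rw [hrev, src_rev, tgt_rev] at h1
  omega

theorem rel_of_pos_lt (h : G.IsBoundaryOrder q T pos) {r : Dart E → Dart E → Prop}
    (hr : T.Pairwise r) {d d' : Dart E} (hd : d ∈ T) (hd' : d' ∈ T)
    (hlt : pos (G.tgt d) < pos (G.tgt d')) : r d d' := by
  obtain ⟨i, hi, rfl⟩ := List.getElem_of_mem hd
  obtain ⟨j, hj, rfl⟩ := List.getElem_of_mem hd'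
  rcases lt_trichotomy i j with hij | rfl | hij
  · exact List.pairwise_iff_getElem.1 hr i j hi hj hij
  · exact absurd hlt (lt_irrefl _)
  · exact absurd hlt (List.pairwise_iff_getElem.1 h.sorted j i hj hi hij).asymm

theorem isOrderedRootedTree (h : G.IsBoundaryOrder q T pos) : G.IsOrderedRootedTree q T where
  nodup := List.pairwise_map.2 (h.sorted.imp fun hlt heq => by
    rw [heq] at hlt
    exact hlt.false)
  mem_iff := h.mem_iff
  tail := by
    rintro L d L' rfl
    rw [or_iff_not_imp_left]
    intro hq
    have hlt := h.src_lt d (by simp)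
    have hs := (h.mem_iff _).2 hq
    have hsorted := h.sorted
    rw [List.pairwise_append, List.pairwise_cons] at hsorted
    rw [List.map_append, List.mem_append, List.map_cons, List.mem_cons] at hs
    rcases hs with hs | hs | hs
    · exact hs
    · rw [hs] at hlt
      exact absurd hlt (lt_irrefl _)
    · obtain ⟨d', hd', hdd'⟩ := List.mem_map.1 hs
      have := hsorted.2.1.1 d' hd'
      rw [hdd'] at this
      omega

theorem exists_compatible [Fintype E] (h : G.IsBoundaryOrder q T pos) :
    ∃ (ref : E → Bool) (lt : E → E → Prop), Compatible T ref lt := by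
  have hnodup : (T.map Prod.fst).Nodup := List.pairwise_map.2 <|
    h.sorted.imp_of_mem fun {d d'} hd hd' hlt heq => by
      rw [h.eq_of_fst_eq hd hd' heq] at hlt
      exact hlt.false
  -- Tree edges are ranked by their place in `T`; the other edges follow in an arbitrary order.
  let key : E → ℕ := fun e => if e ∈ T.map Prod.fst then (T.map Prod.fst).idxOf e else
    (T.map Prod.fst).length + Fintype.equivFin E e
  have key_mem : ∀ {e}, e ∈ T.map Prod.fst → key e = (T.map Prod.fst).idxOf e := fun he => if_pos he
  have key_notMem : ∀ {e}, e ∉ T.map Prod.fst →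
    key e = (T.map Prod.fst).length + Fintype.equivFin E e := fun he => if_neg he
  have key_lt : ∀ {e}, e ∈ T.map Prod.fst → key e < (T.map Prod.fst).length := fun he => by
    rw [key_mem he]
    exact List.idxOf_lt_length_of_mem he
  have key_inj : Function.Injective key := by
    intro e f hef
    by_cases he : e ∈ T.map Prod.fst <;> by_cases hf : f ∈ T.map Prod.fst
    · rw [key_mem he, key_mem hf] at hef
      exact (List.idxOf_inj he).1 hef
    · have := key_lt he
      rw [hef, key_notMem hf] at this
      omega
    · have := key_lt hf
      rw [← hef, key_notMem he] at this
      omega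
    · rw [key_notMem he, key_notMem hf] at hef
      exact (Fintype.equivFin E).injective (Fin.ext (by omega))
  refine ⟨fun e => decide ((e, true) ∈ T), fun e f => key e < key f, ?_, ?_, ?_, ?_⟩
  · exact
      { trichotomous := fun e f hef hfe => key_inj (le_antisymm (not_lt.1 hfe) (not_lt.1 hef))
        irrefl := fun e => lt_irrefl _
        trans := fun e f g => lt_trans }
  · rintro ⟨e, b⟩ hd
    cases b
    · refine decide_eq_false fun ht => ?_
      simpa using h.eq_of_fst_eq hd ht rfl
    · exact decide_eq_true hd
  · refine List.pairwise_iff_getElem.2 fun i j hi hj hij => ?_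
    rw [key_mem (List.getElem_mem hi), key_mem (List.getElem_mem hj), hnodup.idxOf_getElem,
      hnodup.idxOf_getElem]
    exact hij
  · intro d hd f hf
    rw [key_notMem hf]
    exact (key_lt (List.mem_map_of_mem hd)).trans_le (Nat.le_add_right _ _)

theorem exists_first (h : G.IsBoundaryOrder q T pos) {U : Set V} (hU : U.Nonempty) (hq : q ∉ U) :
    ∃ d ∈ T, G.tgt d ∈ U ∧ G.src d ∉ U ∧ ∀ v ∈ U, pos (G.tgt d) ≤ pos v := by
  have hmem := Function.argminOn_mem pos U hU
  have hle : ∀ v ∈ U, pos (Function.argminOn pos U hU) ≤ pos v :=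
    fun v hv => Function.argminOn_le pos U hv
  obtain ⟨d, hd, hdm⟩ := h.exists_mem fun h' => hq (h' ▸ hmem)
  rw [← hdm] at hmem hle
  exact ⟨d, hd, hmem, fun hs => (h.src_lt d hd).not_ge (hle _ hs), hle⟩

/-- Any other tree edge in the cut has a later head: its head is either another vertex of `U` or
comes after its tail in `U`. Edges outside the tree are larger by compatibility. -/
theorem isMinEdge_iff (h : G.IsBoundaryOrder q T pos) {ref : E → Bool} {lt : E → E → Prop}
    (hc : Compatible T ref lt) {U : Set V} {d : Dart E} (hd : d ∈ T) (hdU : G.tgt d ∈ U)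
    (hmin : ∀ v ∈ U, pos (G.tgt d) ≤ pos v) (e : E) :
    IsMinEdge lt (G.cutEdges U) e ↔ e = d.1 := by
  have hlt := hc.total
  have hsrc : G.src d ∉ U := fun hs => (h.src_lt d hd).not_ge (hmin _ hs)
  have hd' : IsMinEdge lt (G.cutEdges U) d.1 := by
    refine ⟨⟨_, hdU, _, hsrc, (G.joins_src_tgt d).symm⟩, ?_⟩
    rintro f ⟨u, hu, v, hv, hj⟩ hne
    by_cases hf : f ∈ T.map Prod.fst
    · obtain ⟨d', hd', rfl⟩ := List.mem_map.1 hf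
      refine h.rel_of_pos_lt (List.pairwise_map.1 hc.extends_order) hd hd' ?_
      rcases (G.joins_src_tgt d').ends_eq hj with ⟨h1, -⟩ | ⟨-, h1⟩
      · exact (hmin _ hu).trans_lt (h1 ▸ h.src_lt d' hd')
      · refine lt_of_le_of_ne (h1 ▸ hmin _ hu) fun heq => hne ?_
        rw [h.tgt_injOn hd hd' (h.inj heq)]
    · exact hc.tree_lt d hd f hf
  constructor
  · intro he
    by_contra hne
    exact asymm_of lt (he.2 _ hd'.1 fun h' => hne h'.symm) (hd'.2 _ he.1 hne)
  · rintro rfl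
    exact hd'

theorem cutDeg_eq [Fintype E] (h : G.IsBoundaryOrder q T pos) {ref : E → Bool}
    {lt : E → E → Prop} (hc : Compatible T ref lt) {U : Set V} (hq : q ∉ U) {u : V} (hu : u ∈ U) :
    (G.cutDeg lt U u : ℤ) =
      G.outDeg Finset.univ U u - if (∀ v ∈ U, pos u ≤ pos v) then 1 else 0 := by
  obtain ⟨d, hd, hdU, hdsrc, hmin⟩ := h.exists_first ⟨u, hu⟩ hq
  have hset : {e | (∃ v ∉ U, G.Joins e u v) ∧ ¬ IsMinEdge lt (G.cutEdges U) e} =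
      ((Finset.univ.filter fun e => ∃ v ∉ U, G.Joins e u v).erase d.1 : Finset E) := by
    ext e
    simp [h.isMinEdge_iff hc hd hdU hmin, and_comm]
  rw [cutDeg, hset, Set.ncard_coe_finset, outDeg]
  split_ifs with hfirst
  · have hud : u = G.tgt d := h.inj (le_antisymm (hfirst _ hdU) (hmin _ hu))
    have hmem : d.1 ∈ Finset.univ.filter fun e => ∃ v ∉ U, G.Joins e u v :=
      Finset.mem_filter.2 ⟨Finset.mem_univ _, _, hdsrc, hud ▸ (G.joins_src_tgt d).symm⟩
    rw [← Finset.card_erase_add_one hmem]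
    push_cast
    ring
  · rw [Finset.erase_eq_of_notMem, sub_zero]
    intro hmem
    obtain ⟨-, v, hv, hj⟩ := Finset.mem_filter.1 hmem
    rcases (G.joins_src_tgt d).ends_eq hj with ⟨h1, -⟩ | ⟨-, h1⟩
    · exact hdsrc (h1 ▸ hu)
    · exact hfirst (h1 ▸ hmin)

/-- Only `q` is outside the vertex set here, and it already has position zero. -/
theorem posIn_erase_root [Fintype V] (h : G.IsBoundaryOrder q T pos) (v : V) :
    posIn pos (Finset.univ.erase q) v = pos v := by
  by_cases hv : v = q
  · subst hv
    rw [posIn_erase_self, h.root]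
  · exact posIn_of_mem (by simpa using hv)

theorem isOuterOrder [Fintype V] [Fintype E] (h : G.IsBoundaryOrder q T pos) :
    G.IsOuterOrder {d | d ∈ T} pos (Finset.univ.erase q) Finset.univ where
  inj := h.inj
  pos_pos := fun v hv => h.pos_pos (Finset.ne_of_mem_erase hv)
  noncrossing := by
    simp_rw [h.posIn_erase_root]
    exact fun e _ f _ => h.noncrossing e f
  tree_inj := h.tgt_injOn
  tree_exists := fun v hv => h.exists_mem (Finset.ne_of_mem_erase hv)
  tree_mem := fun _ _ _ => Finset.mem_univ _
  tree_lt := fun d hd _ => by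
    rw [h.posIn_erase_root]
    exact h.src_lt d hd
  tree_max := by
    simp_rw [h.posIn_erase_root]
    exact fun d hd _ e _ => h.last d hd e

end IsBoundaryOrder

end Multigraph

/-! ### Acyclic-cut internal partial orientations -/

theorem Relation.ReflTransGen.exists_step {α : Type*} {r : α → α → Prop} {a b : α}
    (h : Relation.ReflTransGen r a b) {p : α → Prop} (ha : p a) (hb : ¬ p b) :
    ∃ x y, Relation.ReflTransGen r a x ∧ r x y ∧ Relation.ReflTransGen r y b ∧ p x ∧ ¬ p y := by
  induction h with
  | refl => exact absurd ha hb
  | @tail c d hac hcd ih =>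
    by_cases hc : p c
    · exact ⟨c, d, hac, hcd, .refl, hc, hb⟩
    · obtain ⟨x, y, h1, h2, h3, h4⟩ := ih hc
      exact ⟨x, y, h1, h2, h3.tail hcd, h4⟩

namespace Multigraph

variable {V E : Type*} {G : Multigraph V E} {q : V} {T : List (Dart E)} {pos : V → ℕ}
  {O : Set (Dart E)} {ref : E → Bool} {lt : E → E → Prop}

theorem cutEdges_compl (U : Set V) : G.cutEdges Uᶜ = G.cutEdges U := by
  ext e
  constructor
  · rintro ⟨u, hu, v, hv, hj⟩
    exact ⟨v, not_not.1 hv, u, hu, hj.symm⟩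
  · rintro ⟨u, hu, v, hv, hj⟩
    exact ⟨v, hv, u, not_not.2 hu, hj.symm⟩

theorem IsPartialOrientation.eq_of_fst_eq (hO : IsPartialOrientation O) {d d' : Dart E}
    (hd : d ∈ O) (hd' : d' ∈ O) (h : d.1 = d'.1) : d = d' := by
  obtain ⟨e, b⟩ := d
  obtain ⟨f, b'⟩ := d'
  obtain rfl : e = f := h
  cases b <;> cases b'
  · rfl
  · exact absurd ⟨hd', hd⟩ (hO e)
  · exact absurd ⟨hd, hd'⟩ (hO e)
  · rfl

/-- Every nonempty set of vertices has a source. -/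
theorem IsAcyclic.exists_source [Finite V] (hac : G.IsAcyclic O) (hO : IsPartialOrientation O)
    {U : Set V} (hU : U.Nonempty) : ∃ u ∈ U, ∀ d ∈ O, G.tgt d = u → G.src d ∉ U := by
  by_contra! hcon
  have : Nonempty (Dart E) := by
    obtain ⟨u, hu⟩ := hU
    exact ⟨(hcon u hu).choose⟩
  choose! f hfO hft hfs using hcon
  have hmaps : ∀ {u}, u ∈ U → ∀ n, (fun u => G.src (f u))^[n] u ∈ U := by
    intro u hu n
    induction n with
    | zero => exact hu
    | succ n ih =>
      rw [Function.iterate_succ_apply']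
      exact hfs _ ih
  set p : V → V := fun u => G.src (f u)
  obtain ⟨x, hx, hper⟩ : ∃ x ∈ U, x ∈ Function.periodicPts p := by
    obtain ⟨u, hu⟩ := hU
    obtain ⟨m, n, hmn, heq⟩ := Finite.exists_ne_map_eq_of_infinite fun n : ℕ => p^[n] u
    wlog hlt : m < n generalizing m n
    · exact this n m hmn.symm heq.symm (by omega)
    refine ⟨p^[m] u, hmaps hu m, n - m, by omega, ?_⟩
    change p^[n - m] (p^[m] u) = p^[m] u
    rw [← Function.iterate_add_apply, Nat.sub_add_cancel hlt.le]
    exact heq.symm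
  obtain ⟨N, hN⟩ := Nat.exists_eq_succ_of_ne_zero
    (Function.minimalPeriod_pos_of_mem_periodicPts hper).ne'
  -- Since `p` walks against the orientation, the periodic orbit is read backwards to give a
  -- directed cycle of length `N + 1`.
  refine hac ⟨N, fun i => f (p^[N - i] x), fun i j hij => ?_, fun i => ?_, fun i =>
    hfO _ (hmaps hx _)⟩
  · have h1 := hO.eq_of_fst_eq (hfO _ (hmaps hx _)) (hfO _ (hmaps hx _)) hij
    have h2 := congrArg G.tgt h1
    rw [hft _ (hmaps hx _), hft _ (hmaps hx _)] at h2
    have h3 := Function.iterate_injOn_Iio_minimalPeriod (f := p) (x := x)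
      (Set.mem_Iio.2 (by omega)) (Set.mem_Iio.2 (by omega)) h2
    exact Fin.ext (by omega)
  · rw [hft _ (hmaps hx _)]
    change _ = p _
    rw [← Function.iterate_succ_apply' p, Fin.val_add_one]
    split_ifs with hi
    · rw [hi, Fin.val_last, Nat.sub_self, Nat.sub_zero, ← hN]
      exact (Function.iterate_minimalPeriod (f := p) (x := x)).symm
    · have : (i : ℕ) < N := lt_of_le_of_ne (Nat.lt_succ_iff.1 i.2)
        fun h => hi (Fin.ext h)
      congr 1
      omega

/-- There is an oriented edge from `u` to `v`. -/
def Step (G : Multigraph V E) (O : Set (Dart E)) (u v : V) : Prop :=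
  ∃ d ∈ O, G.src d = u ∧ G.tgt d = v

theorem Step.joins {u v : V} (h : G.Step O u v) : ∃ e, G.Joins e u v := by
  obtain ⟨d, -, rfl, rfl⟩ := h
  exact ⟨d.1, G.joins_src_tgt d⟩

theorem IsAcyclic.not_transGen [Finite V] (hac : G.IsAcyclic O) (hO : IsPartialOrientation O)
    (v : V) : ¬ Relation.TransGen (G.Step O) v v := by
  intro h
  obtain ⟨x, ⟨hvx, hxv⟩, hx⟩ := hac.exists_source hO (U := {x | Relation.ReflTransGen (G.Step O) v x ∧
    Relation.ReflTransGen (G.Step O) x v}) ⟨v, .refl, .refl⟩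
  obtain ⟨y, hvy, d, hd, rfl, hdx⟩ := Relation.TransGen.tail'_iff.1 (h.trans_left hvx)
  exact hx d hd hdx ⟨hvy, (Relation.ReflTransGen.single ⟨d, hd, rfl, hdx⟩).trans hxv⟩

/-- If nothing entered `W`, then `W` would be a potential cut whose minimum edge has its reference
orientation pointing into `W`; cut internality then supplies an oriented edge entering `W` after
all. -/
theorem IsBoundaryOrder.exists_entering (h : G.IsBoundaryOrder q T pos)
    (hc : Compatible T ref lt) (hO : G.IsCutInternal ref lt O) {W : Set V} (hW : W.Nonempty)
    (hq : q ∉ W) : ∃ d ∈ O, G.src d ∉ W ∧ G.tgt d ∈ W := by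
  by_contra! hcon
  obtain ⟨d₀, hd₀, hd₀W, hsrc, hmin⟩ := h.exists_first hW hq
  have hpot : G.IsPotentialCut O W := by
    refine ⟨hW, ⟨q, hq⟩, fun d hd hd' hrev => hcon _ hrev ?_ ?_⟩
    · rwa [src_rev]
    · rwa [tgt_rev]
  obtain ⟨-, d, hd, ⟨u, hu, v, hv, hj⟩, hiff⟩ :=
    hO W hpot d₀.1 ((h.isMinEdge_iff hc hd₀ hd₀W hmin _).2 rfl)
  rw [hc.ref_eq d₀ hd₀] at hiff
  have hds : G.src d ∉ W := fun h' => hsrc (hiff.1 h')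
  rcases (G.joins_src_tgt d).ends_eq hj with ⟨h1, -⟩ | ⟨-, h1⟩
  · exact hds (h1 ▸ hu)
  · exact hcon d hd hds (h1 ▸ hu)

theorem IsBoundaryOrder.isNeutral_of_closed (h : G.IsBoundaryOrder q T pos)
    (hc : Compatible T ref lt) (hO : G.IsCutInternal ref lt O) {W : Set V} (hq : q ∉ W)
    (hcl : ∀ d ∈ O, G.src d ∈ W → G.tgt d ∈ W) {d : Dart E} (hd : d ∈ T) (hdW : G.tgt d ∈ W)
    (hmin : ∀ v ∈ W, pos (G.tgt d) ≤ pos v) : IsNeutral O d.1 := by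
  have hpot : G.IsPotentialCut O Wᶜ := by
    refine ⟨⟨q, hq⟩, ⟨_, not_not.2 hdW⟩, fun d' hd' hdW' hrev => hd' ?_⟩
    have := hcl _ hrev
    rw [src_rev, tgt_rev] at this
    exact this (not_not.1 hdW')
  refine (hO Wᶜ hpot d.1 ?_).1
  rw [cutEdges_compl, h.isMinEdge_iff hc hd hdW hmin]

/-- In an acyclic-cut internal partial orientation, no tree edge is oriented away from the
root. -/
theorem IsBoundaryOrder.notMem_of_mem_tree [Finite V] (h : G.IsBoundaryOrder q T pos)
    (hc : Compatible T ref lt) (hpo : IsPartialOrientation O) (hac : G.IsAcyclic O)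
    (hO : G.IsCutInternal ref lt O) {d : Dart E} (hd : d ∈ T) : d ∉ O := by
  intro hdO
  have hcyc := hac.not_transGen hpo
  have hdstep : G.Step O (G.src d) (G.tgt d) := ⟨d, hdO, rfl, rfl⟩
  -- The set of vertices not reachable from `q` has no entering edge, hence is empty.
  have hqreach : ∀ v, Relation.ReflTransGen (G.Step O) q v := by
    by_contra! hcon
    obtain ⟨d', hd', hs, ht⟩ := h.exists_entering hc hO
      (W := {v | ¬ Relation.ReflTransGen (G.Step O) q v}) hcon (fun h' => h' .refl)
    exact ht ((not_not.1 hs).tail ⟨d', hd', rfl, rfl⟩)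
  -- The set reachable from the head of `d` is closed and, by acyclicity, contains neither `q` nor
  -- the tail of `d`. The tree edge to its first vertex is neutral, so that vertex comes strictly
  -- before the head of `d`.
  set R := {v | Relation.ReflTransGen (G.Step O) (G.tgt d) v}
  have hqR : q ∉ R := fun hqR =>
    hcyc _ (Relation.TransGen.tail' (Relation.ReflTransGen.trans hqR (hqreach _)) hdstep)
  have hpR : G.src d ∉ R := fun hp => hcyc _ (Relation.TransGen.tail' hp hdstep)
  obtain ⟨d₁, hd₁, hd₁R, -, hmin⟩ := h.exists_first (U := R) ⟨G.tgt d, .refl⟩ hqR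
  have hneut := h.isNeutral_of_closed hc hO hqR
    (fun d' hd' hs => Relation.ReflTransGen.tail hs ⟨d', hd', rfl, rfl⟩) hd₁ hd₁R hmin
  have hne : pos (G.tgt d₁) ≠ pos (G.tgt d) := by
    intro heq
    rw [h.tgt_injOn hd₁ hd (h.inj heq)] at hneut
    exact hneut d.2 hdO
  have hlt : pos (G.tgt d₁) < pos (G.tgt d) := lt_of_le_of_ne (hmin _ .refl) hne
  have hposR : ∀ v ∈ R, pos v ≠ pos (G.src d) := fun v hv heq => hpR (h.inj heq ▸ hv)
  rcases lt_or_gt_of_ne (hposR _ hd₁R) with hcase | hcase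
  -- A directed path in `R` jumps over the tail of `d` along an edge from `a` to `b`. A directed
  -- path from `q` to that tail must enter the interval between `b` and `a`, from a vertex `x`
  -- outside `R`, and thus crosses that edge.
  · obtain ⟨a, b, hua, hab, -, ha, hb⟩ := Relation.ReflTransGen.exists_step hd₁R
      (p := fun v => pos (G.src d) < pos v) (h.src_lt d hd) (by omega)
    have haR : a ∈ R := hua
    have hbR : b ∈ R := hua.tail hab
    have hb' : pos b < pos (G.src d) := lt_of_le_of_ne (not_lt.1 hb) (hposR b hbR)
    obtain ⟨x, y, -, hxy, hyp, hx, hy⟩ := (hqreach (G.src d)).exists_step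
      (p := fun v => ¬ (pos b < pos v ∧ pos v < pos a)) (by rw [h.root]; omega)
      (not_not.2 ⟨hb', ha⟩)
    have hxR : x ∉ R := fun hx' => hpR ((Relation.ReflTransGen.tail hx' hxy).trans hyp)
    have hxa : pos x ≠ pos a := fun h' => hxR (h.inj h' ▸ haR)
    have hxb : pos x ≠ pos b := fun h' => hxR (h.inj h' ▸ hbR)
    obtain ⟨hby, hya⟩ := not_not.1 hy
    obtain ⟨e, he⟩ := hxy.joins
    obtain ⟨f, hf⟩ := hab.joins
    rcases lt_or_gt_of_ne hxb with hxb' | hxb'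
    · exact h.noncrossing e f x b y a he hf.symm hxb' hby hya
    · exact h.noncrossing f e b y a x hf.symm he.symm hby hya (by omega)
  -- Now a path in `R` leads from the head of `d`, or from beyond it, to a vertex `b` strictly
  -- between tail and head. Starting at the head contradicts `last`; starting beyond it crosses `d`.
  · obtain ⟨a, b, hua, hab, -, ha, hb⟩ := Relation.ReflTransGen.exists_step hd₁R
      (p := fun v => pos (G.tgt d) ≤ pos v) le_rfl (by omega)
    have hbR : b ∈ R := hua.tail hab
    have hbmin := hmin b hbR
    obtain ⟨e, he⟩ := hab.joins
    rcases ha.eq_or_lt with ha' | ha'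
    · rw [← h.inj ha'] at he
      have := h.last d hd e b he (by omega)
      omega
    · exact h.noncrossing d.1 e (G.src d) b (G.tgt d) a (G.joins_src_tgt d) he.symm
        (by omega) (by omega) ha'

/-- A source `u` of `U` serves as witness: its incoming edges come from outside `U`, and there is at
least one because some edge enters `{u}`. -/
theorem IsBoundaryOrder.divisor_mem_subparking [Finite V] [Fintype E]
    (h : G.IsBoundaryOrder q T pos) (hc : Compatible T ref lt)
    (hO : O ∈ G.acyclicCutInternal ref lt) : G.divisor q O ∈ G.subparking q lt := by
  obtain ⟨hpo, hac, hci⟩ := hO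
  intro U hU hq
  obtain ⟨u, hu, hsource⟩ := hac.exists_source hpo hU
  have huq : u ≠ q := fun h' => hq (h' ▸ hu)
  refine ⟨⟨u, huq⟩, hu, ?_⟩
  have hinj : Set.InjOn Prod.fst {d ∈ O | G.tgt d = u} :=
    fun d hd d' hd' heq => hpo.eq_of_fst_eq hd.1 hd'.1 heq
  have himage : Prod.fst '' {d ∈ O | G.tgt d = u} ⊆
      (Finset.univ.filter fun e => ∃ v ∉ U, G.Joins e u v : Finset E) := by
    rintro _ ⟨d, ⟨hd, rfl⟩, rfl⟩
    exact Finset.mem_filter.2 ⟨Finset.mem_univ _, _, hsource d hd rfl, (G.joins_src_tgt d).symm⟩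
  have hpos : 0 < {d ∈ O | G.tgt d = u}.ncard := by
    obtain ⟨d, hd, -, hdu⟩ := h.exists_entering hc hci (W := {u}) ⟨u, rfl⟩ (fun h' => huq h'.symm)
    exact (Set.ncard_pos (Set.toFinite _)).2 ⟨d, hd, hdu⟩
  have hle : {d ∈ O | G.tgt d = u}.ncard ≤ G.outDeg Finset.univ U u := by
    rw [← hinj.ncard_image, outDeg, ← Set.ncard_coe_finset]
    exact Set.ncard_le_ncard himage
  rw [h.cutDeg_eq hc hq hu]
  change 0 ≤ ({d ∈ O | G.tgt d = u}.ncard : ℤ) - 1 ∧ ({d ∈ O | G.tgt d = u}.ncard : ℤ) - 1 < _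
  refine ⟨by omega, ?_⟩
  split_ifs with hfirst
  -- If `u` is the first vertex of `U`, its tree edge leaves `U` but is not oriented into `u`, so
  -- the inequality is strict.
  · have hlt : {d ∈ O | G.tgt d = u}.ncard < G.outDeg Finset.univ U u := by
      obtain ⟨d, hd, hdu⟩ := h.exists_mem huq
      rw [← hinj.ncard_image, outDeg, ← Set.ncard_coe_finset]
      refine Set.ncard_lt_ncard ((Set.ssubset_iff_of_subset himage).2 ⟨d.1, ?_, ?_⟩)
      · refine Finset.mem_filter.2 ⟨Finset.mem_univ _, G.src d, fun hs => ?_,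
          hdu ▸ (G.joins_src_tgt d).symm⟩
        have := h.src_lt d hd
        have := hfirst _ hs
        rw [hdu] at *
        omega
      · rintro ⟨d', ⟨hd', hdu'⟩, heq⟩
        refine h.notMem_of_mem_tree hc hpo hac hci hd ?_
        rcases Dart.eq_or_eq_rev heq with rfl | rfl
        · exact hd'
        · have := h.src_lt d hd
          rw [tgt_rev] at hdu'
          rw [hdu, hdu'] at this
          exact absurd this (lt_irrefl _)
    omega
  · omega

/-- A vertex of least height in a set without `q` receives an edge from outside the set. So every
potential cut has `q` in `U`, and the tree edge into the first vertex of `Uᶜ` is its minimum edge.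
-/
theorem IsInternal.mem_acyclicCutInternal [Fintype V] [Fintype E]
    (h : G.IsBoundaryOrder q T pos) (hc : Compatible T ref lt)
    (hO : G.IsInternal {d | d ∈ T} pos (Finset.univ.erase q) Finset.univ O) :
    O ∈ G.acyclicCutInternal ref lt := by
  obtain ⟨ρ, hρ⟩ := hO.height
  have hS : ∀ {W : Set V}, q ∉ W → W ⊆ (Finset.univ.erase q : Finset V) := fun hq v hv =>
    Finset.mem_coe.2 (Finset.mem_erase.2 ⟨fun h' => hq (h' ▸ hv), Finset.mem_univ v⟩)
  have henter : ∀ W : Set V, W.Nonempty → q ∉ W → ∃ d ∈ O, G.src d ∉ W ∧ G.tgt d ∈ W := by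
    intro W hW hq
    have hmem := Function.argminOn_mem ρ W hW
    obtain ⟨d, hd, hdv⟩ := hO.reach _ (hS hq hmem)
    refine ⟨d, hd, fun hs => ?_, hdv ▸ hmem⟩
    have h1 := hρ d hd (hS hq hs)
    rw [hdv] at h1
    exact h1.not_ge (Function.argminOn_le ρ W hs)
  refine ⟨hO.partialOrientation, ?_, ?_⟩
  · rintro ⟨n, d, -, hcyc, hd⟩
    -- All heads lie in `S`, so the height would increase all the way around a directed cycle.
    obtain ⟨i, hi⟩ := Finite.exists_max fun i => ρ (G.tgt (d i))
    have h1 := hρ (d (i + 1)) (hd _) (hcyc i ▸ hO.tgt_mem _ (hd i))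
    rw [← hcyc i] at h1
    exact h1.not_ge (hi (i + 1))
  · intro U hU e he
    have hleave : ∀ d ∈ O, G.src d ∉ U → G.tgt d ∉ U := by
      intro d hd hs ht
      refine hU.2.2 (Dart.rev d) ?_ ?_ ?_
      · rwa [src_rev]
      · rwa [tgt_rev]
      · rwa [Dart.rev_rev]
    by_cases hq : q ∈ U
    · obtain ⟨d₀, hd₀, hd₀U, hsrc, hmin⟩ := h.exists_first hU.2.1 (not_not.2 hq)
      rw [← cutEdges_compl, h.isMinEdge_iff hc hd₀ hd₀U hmin] at he
      subst he
      refine ⟨hO.neutral Uᶜ (hS (not_not.2 hq)) hleave d₀ hd₀ hd₀U hmin, ?_⟩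
      obtain ⟨d, hd, hs, ht⟩ := henter Uᶜ hU.2.1 (not_not.2 hq)
      refine ⟨d, hd, ⟨_, not_not.1 hs, _, ht, G.joins_src_tgt d⟩, ?_⟩
      rw [hc.ref_eq d₀ hd₀]
      exact iff_of_true (not_not.1 hs) (not_not.1 hsrc)
    · obtain ⟨d, hd, hs, ht⟩ := henter U hU.1 hq
      exact absurd ht (hleave d hd hs)

end Multigraph

/-! ### Transfer to the original statement: divisors, standard monomials and the Tutte polynomial -/

namespace Multigraph

variable {V E : Type*} {G : Multigraph V E} {q : V} {T : List (Dart E)} {pos : V → ℕ}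
  {ref : E → Bool} {lt : E → E → Prop}

/-- Extend a function by zero at the root. -/
noncomputable def extendZero (q : V) (c : {v : V // v ≠ q} → ℤ) (v : V) : ℤ :=
  if hv : v ≠ q then c ⟨v, hv⟩ else 0

theorem extendZero_of_ne (c : {v : V // v ≠ q} → ℤ) (v : {v : V // v ≠ q}) :
    extendZero q c v.1 = c v := dif_pos v.2

theorem extendZero_root (c : {v : V // v ≠ q} → ℤ) : extendZero q c q = 0 :=
  dif_neg (not_not.2 rfl)

theorem extendZero_injective : Function.Injective (extendZero q) := fun c c' h => funext fun v => by
  rw [← extendZero_of_ne c, ← extendZero_of_ne c', h]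

theorem sum_extendZero [Fintype V] (c : {v : V // v ≠ q} → ℤ) :
    ∑ v, extendZero q c v = ∑ v, c v := by
  rw [Fintype.sum_eq_add_sum_subtype_ne _ q, extendZero_root, zero_add]
  exact Finset.sum_congr rfl fun v _ => extendZero_of_ne c v

theorem IsBoundaryOrder.extendZero_mem_subpark_iff [Fintype V] [Fintype E]
    (h : G.IsBoundaryOrder q T pos) (hc : Compatible T ref lt) (c : {v : V // v ≠ q} → ℤ) :
    extendZero q c ∈ G.subpark pos (Finset.univ.erase q) Finset.univ ↔ c ∈ G.subparking q lt := by
  have hsub : ∀ U : Set V, U ⊆ (Finset.univ.erase q : Finset V) ↔ q ∉ U := by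
    intro U
    refine ⟨fun hU hq => by simpa using hU hq, fun hq v hv => ?_⟩
    exact Finset.mem_coe.2 (Finset.mem_erase.2 ⟨fun h' => hq (h' ▸ hv), Finset.mem_univ v⟩)
  constructor
  · rintro ⟨-, hU⟩ U hne hq
    obtain ⟨u, hu, hu0, hu1⟩ := hU U hne ((hsub U).2 hq)
    have huq : u ≠ q := fun h' => hq (h' ▸ hu)
    rw [extendZero_of_ne c ⟨u, huq⟩] at hu0 hu1
    exact ⟨⟨u, huq⟩, hu, hu0, by rwa [h.cutDeg_eq hc hq hu]⟩
  · refine fun hU => ⟨fun v hv => ?_, fun U hne hUS => ?_⟩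
    · obtain rfl : v = q := by simpa using hv
      exact extendZero_root c
    · obtain ⟨u, hu, hu0, hu1⟩ := hU U hne ((hsub U).1 hUS)
      refine ⟨u, hu, ?_⟩
      rw [extendZero_of_ne, ← h.cutDeg_eq hc ((hsub U).1 hUS) hu]
      exact ⟨hu0, hu1⟩

theorem IsBoundaryOrder.exists_extendZero_eq [Fintype V] [Fintype E] {c : V → ℤ}
    (hc : c ∈ G.subpark pos (Finset.univ.erase q) Finset.univ) : ∃ c', extendZero q c' = c := by
  refine ⟨fun v => c v.1, funext fun v => ?_⟩
  by_cases hv : v = q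
  · rw [hv, extendZero_root, hc.1 q (by simp)]
  · exact extendZero_of_ne _ ⟨v, hv⟩

theorem IsBoundaryOrder.subparking_eq [Fintype V] [Fintype E] (h : G.IsBoundaryOrder q T pos)
    (hc : Compatible T ref lt) : G.subparking q lt = G.divisor q '' G.acyclicCutInternal ref lt := by
  ext c
  constructor
  · intro hcs
    obtain ⟨O, hO, hOc⟩ := h.isOuterOrder.exists_isInternal
      ((h.extendZero_mem_subpark_iff hc c).2 hcs)
    refine ⟨O, hO.mem_acyclicCutInternal h hc, funext fun v => ?_⟩
    rw [← extendZero_of_ne c, hOc v.1 (by simpa using v.2)]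
    rfl
  · rintro ⟨O, hO, rfl⟩
    exact h.divisor_mem_subparking hc hO

/-- Divisibility by the generator of `U` means that no `u` in `U` satisfies the bound, so standard
monomials and subparking functions have the same exponents. -/
theorem mem_subparking_iff_forall_not_le (c : {v : V // v ≠ q} →₀ ℕ) [Finite V] :
    (fun v => (c v : ℤ)) ∈ G.subparking q lt ↔
      ∀ m ∈ {m | ∃ U : Finset {v : V // v ≠ q}, U.Nonempty ∧ m = ∑ u ∈ U, Finsupp.single u
          (G.cutDeg lt (Subtype.val '' (U : Set {v : V // v ≠ q})) u.1)}, ¬ m ≤ c := by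
  have := Fintype.ofFinite {v : V // v ≠ q}
  constructor
  · rintro hc _ ⟨U, hU, rfl⟩ hle
    rw [sum_single_le_iff] at hle
    obtain ⟨u, hu, -, hlt⟩ := hc (Subtype.val '' (U : Set {v : V // v ≠ q}))
      ((Finset.coe_nonempty.2 hU).image _) (by simp)
    have hu' : u ∈ U := Finset.mem_coe.1 (Subtype.val_injective.mem_set_image.1 hu)
    have := hle u hu'
    simp only at hlt
    omega
  · intro hc U hU hq
    set W : Finset {v : V // v ≠ q} := Finset.univ.filter fun v => v.1 ∈ U
    have hW : Subtype.val '' (W : Set {v : V // v ≠ q}) = U := by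
      ext v
      simp only [W, Set.mem_image, Finset.mem_coe, Finset.mem_filter, Finset.mem_univ, true_and]
      exact ⟨fun ⟨u, hu, huv⟩ => huv ▸ hu, fun hv => ⟨⟨v, fun h' => hq (h' ▸ hv)⟩, hv, rfl⟩⟩
    have hWne : W.Nonempty := by
      obtain ⟨v, hv⟩ := hU
      exact ⟨⟨v, fun h' => hq (h' ▸ hv)⟩, by simpa [W] using hv⟩
    have := hc _ ⟨W, hWne, rfl⟩
    rw [sum_single_le_iff, hW] at this
    push Not at this
    obtain ⟨u, hu, hlt⟩ := this
    exact ⟨u, (Finset.mem_filter.1 hu).2, Int.natCast_nonneg _, Int.ofNat_lt.2 hlt⟩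

theorem numComponents_eq_components [Fintype V] (B : Finset E) :
    G.numComponents (B : Set E) = G.components (Finset.univ.erase q) B := by
  refine natCard_quot_eq_of_eqvGen (fun u v h => ?_) fun u v h => ?_
  · exact Relation.EqvGen.rel _ _ (Or.inl h)
  · rcases h with h | ⟨hu, hv⟩
    · exact Relation.EqvGen.rel _ _ h
    · obtain rfl : u = q := by simpa using hu
      obtain rfl : v = u := by simpa using hv
      exact Relation.EqvGen.refl _

theorem Connected.numComponents_univ [Nonempty V] (hG : G.Connected) :
    G.numComponents Set.univ = 1 := by
  rw [numComponents, Nat.card_eq_one_iff_unique]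
  refine ⟨⟨?_⟩, ‹Nonempty V›.map (Quot.mk _)⟩
  rintro ⟨u⟩ ⟨v⟩
  refine Quot.eqvGen_sound ?_
  induction hG u v with
  | refl => exact .refl _
  | tail _ h ih =>
    obtain ⟨e, he⟩ := h
    exact ih.trans _ _ _ (.rel _ _ ⟨e, Set.mem_univ e, he⟩)

theorem Connected.aeval_tutte [Fintype V] [Fintype E] (hG : G.Connected) (q : V) {R : Type*}
    [CommRing R] [Algebra ℤ R] (t : R) : MvPolynomial.aeval ![0, t] G.tutte =
      G.tutteValue t (Finset.univ.erase q) Finset.univ := by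
  have : Nonempty V := ⟨q⟩
  rw [tutte, tutteValue, map_sum, Finset.powerset_univ]
  refine Finset.sum_congr rfl fun B _ => ?_
  rw [hG.numComponents_univ, numComponents_eq_components (q := q), Nat.card_eq_fintype_card,
    Finset.card_erase_add_one (Finset.mem_univ q), Finset.card_univ]
  simp

theorem IsBoundaryOrder.ofPowerSeries_hilbertSeries [Fintype V] [Fintype E] (k : Type*) [Field k]
    (hG : G.Connected) (h : G.IsBoundaryOrder q T pos) (hc : Compatible T ref lt) :
    HahnSeries.ofPowerSeries ℤ ℤ (hilbertSeries (G.subparkingIdeal k q lt)) =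
      HahnSeries.single G.genus (1 : ℤ) *
        MvPolynomial.aeval ![(0 : LaurentSeries ℤ), HahnSeries.single (-1 : ℤ) (1 : ℤ)]
          G.tutte := by
  have hV : Nonempty V := ⟨q⟩
  rw [subparkingIdeal_eq_span]
  set s := {m : {v : V // v ≠ q} →₀ ℕ | ∃ U : Finset {v : V // v ≠ q}, U.Nonempty ∧
    m = ∑ u ∈ U, Finsupp.single u
      (G.cutDeg lt (Subtype.val '' (U : Set {v : V // v ≠ q})) u.1)}
  set φ : ({v : V // v ≠ q} →₀ ℕ) → V → ℤ := fun c => extendZero q fun v => (c v : ℤ)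
  have hφ : Function.Injective φ := fun c c' hcc' => Finsupp.ext fun v => by
    exact_mod_cast congrFun (extendZero_injective hcc') v
  have hmem : ∀ c, φ c ∈ G.subpark pos (Finset.univ.erase q) Finset.univ ↔ ∀ m ∈ s, ¬ m ≤ c :=
    fun c => (h.extendZero_mem_subpark_iff hc _).trans (mem_subparking_iff_forall_not_le c)
  have himage : φ '' {c | ∀ m ∈ s, ¬ m ≤ c} =
      G.subpark pos (Finset.univ.erase q) Finset.univ := by
    ext c
    constructor
    · rintro ⟨c, hcs, rfl⟩
      exact (hmem c).2 hcs
    · intro hcs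
      obtain ⟨c', rfl⟩ := exists_extendZero_eq hcs
      -- Subparking functions are nonnegative, so `toNat` loses nothing.
      have hφc : φ (Finsupp.equivFunOnFinite.symm fun v => (c' v).toNat) = extendZero q c' := by
        simp only [φ]
        congr 1
        ext v
        have := subpark_nonneg hcs v.1
        rw [extendZero_of_ne] at this
        simpa using this
      exact ⟨_, (hmem _).1 (hφc ▸ hcs), hφc⟩
  have hfin : {c | ∀ m ∈ s, ¬ m ≤ c}.Finite :=
    Set.Finite.of_finite_image (himage ▸ subpark_finite) hφ.injOn
  have hdeg : ∀ c, (c.degree : ℤ) = ∑ v, φ c v := fun c => by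
    rw [sum_extendZero, Finsupp.degree_eq_sum]
    push_cast
    rfl
  have hgenus : ((Finset.univ : Finset E).card : ℤ) - (Finset.univ.erase q : Finset V).card =
      G.genus := by
    have := Finset.card_erase_add_one (Finset.mem_univ q)
    rw [genus, Nat.card_eq_fintype_card, Nat.card_eq_fintype_card, Finset.card_univ,
      ← Finset.card_univ (α := V)]
    omega
  rw [ofPowerSeries_hilbertSeries_span_monomial s hfin]
  simp_rw [hdeg]
  rw [← finsum_mem_image (f := fun c : V → ℤ => (HahnSeries.single (∑ v, c v) 1 : LaurentSeries ℤ))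
    hφ.injOn, himage, h.isOuterOrder.finsum_subpark, hG.aeval_tutte q, hgenus]

end Multigraph

theorem mainTheorem8 {V E : Type*} [Fintype V] [Fintype E] (k : Type*) [Field k]
    (G : Multigraph V E) (hconn : G.Connected) (hout : G.IsOuterplanar) (q : V) :
    (∃ T, G.IsBoundaryTree q T) ∧
    ∀ T, G.IsBoundaryTree q T →
      G.IsOrderedRootedTree q T ∧
      (∃ (ref : E → Bool) (lt : E → E → Prop), Multigraph.Compatible T ref lt) ∧
      ∀ (ref : E → Bool) (lt : E → E → Prop), Multigraph.Compatible T ref lt →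
        (HahnSeries.ofPowerSeries ℤ ℤ (hilbertSeries (G.subparkingIdeal k q lt)) =
          HahnSeries.single G.genus (1 : ℤ) *
            MvPolynomial.aeval ![(0 : LaurentSeries ℤ), HahnSeries.single (-1 : ℤ) (1 : ℤ)]
              G.tutte) ∧
        G.subparking q lt = G.divisor q '' G.acyclicCutInternal ref lt := by
  refine ⟨hout.exists_isBoundaryTree q, fun T hT => ?_⟩
  obtain ⟨pos, h⟩ := hT.exists_isBoundaryOrder hconn
  exact ⟨h.isOrderedRootedTree, h.exists_compatible, fun ref lt hc =>
    ⟨h.ofPowerSeries_hilbertSeries k hconn hc, h.subparking_eq hc⟩⟩
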